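/- Let $d\ge 1$, let $\mathcal S_d=\{x\in[0,1]^d:\|x\|_1\le 1\}$, where $\|x\|_1=\sum_{i=1}^d|x_i|$, and write $[d]=\{1,\dots,d\}$. Let $F$ be the cumulative distribution function of a Borel probability measure on $\mathbb R^d$, $F(x)=\mathbb P(X_1\le x)$ (coordinatewise order), such that $F$ is three times continuously differentiable on $\mathcal S_d$ (up to the boundary; partial derivatives at boundary points are taken from within $\mathcal S_d$) and $F(x)=0$ for every $x\in\mathcal S_d$ having a zero coordinate. Let $X_1,\dots,X_n$ be independent random vectors with c.d.f. $F$, let $F_n(x)=n^{-1}\sum_{j=1}^n \mathbf 1_{\{X_j\le x\}}$ be the empirical c.d.f., and for $m\in\mathbb N$ and $x\in\mathcal S_d$ let $$F^{\star}_{n,m}(x)=\sum_{k\in\mathbb N_0^d,\ \|k\|_1\le m}F_n(k/m)\,P_{k,m}(x),\qquad P_{k,m}(x)=\frac{m!}{(m-\|k\|_1)!\prod_{i}k_i!}\,(1-\|x\|_1)^{m-\|k\|_1}\prod_{i}x_i^{k_i}$$ be the Bernstein c.d.f. estimator. Let $I_\nu(z)=\sum_{k\ge0}\frac{(z/2)^{2k+\nu}}{k!\,(k+\nu)!}$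 for $\nu\in\{0,1\}$. Let $\mathcal J\subseteq[d]$, let $\lambda_i>0$ be fixed for $i\in\mathcal J$, let $x_i\in(0,1)$ be fixed (independent of $m$) for $i\in[d]\setminus\mathcal J$, and put $x_i=\lambda_i/m$ for $i\in\mathcal J$; only those $m$ with $x=(x_1,\dots,x_d)\in\mathcal S_d$ are considered. Write $g(x)|_{x_{\mathcal J}=0}$ for the value of $g$ at the point obtained from $x$ by setting the coordinates in $\mathcal J$ to $0$. Then, as $m\to\infty$ and uniformly in $n\ge1$ (in particular as $n\to\infty$ with $m=m(n)\to\infty$), $$\begin{aligned}\operatorname{Var}(F^{\star}_{n,m}(x))&=n^{-1}m^{-1}\sum_{i\in[d]}\frac{\partial F}{\partial x_i}(x)\Big|_{x_{\mathcal J}=0}\Big\{\lambda_i\big(1-e^{-2\lambda_i}(I_0(2\lambda_i)+I_1(2\lambda_i))\big)\mathbf 1_{\{i\in\mathcal J\}}-m^{1/2}\sqrt{\pi^{-1}x_i(1-x_i)}\,\mathbf 1_{\{i\notin\mathcal J\}}\Big\}\\&\quad+n^{-1}F(x)(1-F(x))\,\mathbf 1_{\{\mathcal J=\emptyset\}}+O(n^{-1}m^{-2})+o(n^{-1}m^{-1/2})\,\mathbf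 1_{\{\mathcal J\ne[d]\}},\end{aligned}$$ where the constant in the $O$ term depends only on $F$, $d$, $\mathcal J$ and $(\lambda_i)_{i\in\mathcal J}$, while the $o$ term may depend in addition on $(x_i)_{i\notin\mathcal J}$. Moreover, for every $x\in\mathcal S_d$ with $x_i=0$ for some $i\in[d]$, and all $n,m\ge1$, one has $F^{\star}_{n,m}(x)=0$ almost surely and $\operatorname{Var}(F^{\star}_{n,m}(x))=0$. -/

import Mathlib

open MeasureTheory ProbabilityTheory

namespace BernsteinSimplex

noncomputable section

/-- The `d`-dimensional unit simplex `{x ∈ [0,1]^d : ‖x‖₁ ≤ 1}`. -/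
def simplex (d : ℕ) : Set (Fin d → ℝ) :=
  {x | (∀ i, x i ∈ Set.Icc (0 : ℝ) 1) ∧ ∑ i, |x i| ≤ 1}

/-- The index set `ℕ₀^d ∩ m S_d`, as a finite set; see `mem_grid`. -/
def grid (d m : ℕ) : Finset (Fin d → ℕ) :=
  (Fintype.piFinset fun _ => Finset.range (m + 1)).filter fun k => ∑ i, k i ≤ m

theorem mem_grid {d m : ℕ} {k : Fin d → ℕ} : k ∈ grid d m ↔ ∑ i, k i ≤ m := by
  simp only [grid, Finset.mem_filter, Fintype.mem_piFinset, Finset.mem_range]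
  refine ⟨fun h => h.2, fun h => ⟨fun i => ?_, h⟩⟩
  have := Finset.single_le_sum (f := k) (fun _ _ => Nat.zero_le _) (Finset.mem_univ i)
  omega

/-- The probability `P_{k,m}(x)` of the value `k` under the `Multinomial(m, x)` distribution. -/
def multinomialWeight {d : ℕ} (k : Fin d → ℕ) (m : ℕ) (x : Fin d → ℝ) : ℝ :=
  (m.factorial : ℝ) / (((m - ∑ i, k i).factorial : ℝ) * ∏ i, ((k i).factorial : ℝ))
    * (1 - ∑ i, |x i|) ^ (m - ∑ i, k i) * ∏ i, x i ^ k i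

/-- The Bernstein polynomial of order `m` for a function `G`. -/
def bernsteinPoly {d : ℕ} (G : (Fin d → ℝ) → ℝ) (m : ℕ) (x : Fin d → ℝ) : ℝ :=
  ∑ k ∈ grid d m, G (fun i => (k i : ℝ) / (m : ℝ)) * multinomialWeight k m x

/-- The cumulative distribution function `F(x) = μ((-∞, x])` of a measure on `ℝ^d`. -/
def jointCDF {d : ℕ} (μ : Measure (Fin d → ℝ)) (x : Fin d → ℝ) : ℝ :=
  μ.real (Set.Iic x)

/-- The empirical cumulative distribution function of `n` observations in `ℝ^d`. -/
def empiricalCDF {d n : ℕ} (obs : Fin n → Fin d → ℝ) (x : Fin d → ℝ) : ℝ :=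
  (n : ℝ)⁻¹ * ∑ j, (Set.Iic x).indicator (fun _ => (1 : ℝ)) (obs j)

/-- The Bernstein c.d.f. estimator: the Bernstein polynomial of the empirical c.d.f. -/
def bernsteinEstimator {d n : ℕ} (obs : Fin n → Fin d → ℝ) (m : ℕ) (x : Fin d → ℝ) : ℝ :=
  bernsteinPoly (empiricalCDF obs) m x

/-- The modified Bessel function of the first kind of integer order `ν`. -/
def besselI (ν : ℕ) (z : ℝ) : ℝ :=
  ∑' k : ℕ, (z / 2) ^ (2 * k + ν) / ((k.factorial : ℝ) * ((k + ν).factorial : ℝ))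

/-- The point with coordinates `lam i / m` for `i ∈ J` and `x i` for `i ∉ J`. -/
def nearBoundary {d : ℕ} (J : Finset (Fin d)) (lam x : Fin d → ℝ) (m : ℕ) : Fin d → ℝ :=
  fun i => if i ∈ J then lam i / (m : ℝ) else x i

/-- The point `x` with its coordinates in `J` replaced by `0`. -/
def zeroOn {d : ℕ} (J : Finset (Fin d)) (x : Fin d → ℝ) : Fin d → ℝ :=
  fun i => if i ∈ J then 0 else x i

/-- The partial derivative `∂G/∂x_i` of a function on the simplex
(one-sided, from within the simplex, at boundary points). -/
def partialDeriv {d : ℕ} (G : (Fin d → ℝ) → ℝ) (i : Fin d) (x : Fin d → ℝ) : ℝ :=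
  fderivWithin ℝ G (simplex d) x (Pi.single i 1)

/-- The leading terms of the variance of the Bernstein c.d.f. estimator for `F`, based on `n`
observations, at the point `nearBoundary J lam x m`. -/
def leadingVariance {d : ℕ} (F : (Fin d → ℝ) → ℝ) (J : Finset (Fin d)) (lam x : Fin d → ℝ)
    (n m : ℕ) : ℝ :=
  (n : ℝ)⁻¹ * (m : ℝ)⁻¹ * ∑ i, partialDeriv F i (zeroOn J x) *
      (if i ∈ J then
        lam i * (1 - Real.exp (-2 * lam i) * (besselI 0 (2 * lam i) + besselI 1 (2 * lam i)))
      else -(√(m : ℝ) * √(Real.pi⁻¹ * (x i * (1 - x i)))))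
    + (if J = ∅ then
        (n : ℝ)⁻¹ * (F (nearBoundary J lam x m) * (1 - F (nearBoundary J lam x m)))
      else 0)

end

end BernsteinSimplex

open BernsteinSimplex

namespace BernsteinSimplex

/-! The estimator averages n i.i.d. values of a bounded kernel, so its variance is 1/n times V = E
F((K∧L)/m) − (E F(K/m))², where K and L are independent Multinomial(m, x) vectors and K∧L is the
coordinatewise minimum (`variance_bernsteinEstimator`). Uniformity in n is then automatic, and only
V has to be expanded. There are three regimes.

J empty: expand F at x. Quadratic remainders are O(1/m), and E K = m x kills the linear term of E
F(K/m). In E F((K∧L)/m) the linear term contributes −E|K_i − L_i|/(2m). Writing |s| = (2/π)∫ (1 −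
cos(st))/t² dt over t > 0, this moment becomes an integral of 1 − |φ|^(2m), with φ the
characteristic function of one trial. Dominated convergence to the Gaussian limit gives E|K_i − L_i|
~ 2√(m x_i(1 − x_i)/π) (`tendsto_multinomialMean_abs_sub`).

J everything: expand at 0, where F vanishes. Both the second moments of K/m and (E F(K/m))² are
O(m⁻²). The marginals are nearly Poisson, and E min(K_i, L_i) is within O(1/m) of its Poisson value
(`exists_multinomialMean_min_le`). That value is computed from E[N f(N)] = r E f(N+1), which leaves
the probabilities of N' = N and N' = N + 1, i.e. Bessel series (`poissonMean_min`).

J proper and nonempty: no expansion is needed. With j in J, 0 ≤ V ≤ E F(K/m) = O(x_j) = O(1/m),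
since F is Lipschitz and vanishes on the face x_j = 0. The m^(−1/2) terms of the claimed expansion
carry tangential derivatives of F on that face, which are zero (`partialDeriv_eq_zero_of_face`).
Everything left is absorbed in o(m^(−1/2)). -/

/-- The mean of `f` under the `Multinomial(m, x)` distribution. -/
noncomputable def multinomialMean {d : ℕ} (x : Fin d → ℝ) (m : ℕ) (f : (Fin d → ℕ) → ℝ) : ℝ :=
  ∑ k ∈ grid d m, f k * multinomialWeight k m x

/-! ### Multinomial means: recursion, moments, marginals -/

section Multinomial

variable {d : ℕ} {x : Fin d → ℝ} {m : ℕ}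

theorem sum_add_single (k : Fin d → ℕ) (i : Fin d) :
    ∑ j, (k + Pi.single i 1 : Fin d → ℕ) j = ∑ j, k j + 1 := by
  simp [Finset.sum_add_distrib]

theorem prod_add_single (g : Fin d → ℕ → ℝ) (k : Fin d → ℕ) (i : Fin d) :
    ∏ j, g j ((k + Pi.single i 1 : Fin d → ℕ) j) = g i (k i + 1) * ∏ j ∈ Finset.univ.erase i, g j (k j) := by
  rw [← Finset.mul_prod_erase _ _ (Finset.mem_univ i)]
  congr 1
  · simp
  · refine Finset.prod_congr rfl fun j hj => ?_
    simp [Pi.single_eq_of_ne (Finset.ne_of_mem_erase hj)]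

theorem multinomialWeight_add_single (k : Fin d → ℕ) (i : Fin d) :
    ((k i + 1 : ℕ) : ℝ) * multinomialWeight (k + Pi.single i 1) (m + 1) x
      = (m + 1) * (x i * multinomialWeight k m x) := by
  have h1 := prod_add_single (fun _ n => (n.factorial : ℝ)) k i
  have h2 := prod_add_single (fun j n => x j ^ n) k i
  simp only [multinomialWeight, sum_add_single, Nat.add_sub_add_right, h1, h2]
  rw [← Finset.mul_prod_erase _ (fun j => ((k j).factorial : ℝ)) (Finset.mem_univ i),
    ← Finset.mul_prod_erase _ (fun j => x j ^ k j) (Finset.mem_univ i),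
    Nat.factorial_succ, Nat.factorial_succ]
  have h3 : (∏ j ∈ Finset.univ.erase i, ((k j).factorial : ℝ)) ≠ 0 :=
    Finset.prod_ne_zero_iff.2 fun j _ => by positivity
  have h4 : ((m - ∑ j, k j).factorial : ℝ) ≠ 0 := by positivity
  have h5 : ((k i).factorial : ℝ) ≠ 0 := by positivity
  have h6 : ((k i : ℝ) + 1) ≠ 0 := by positivity
  push_cast
  field_simp
  ring

theorem multinomialWeight_succ {k : Fin d → ℕ} (hk : ∑ i, k i ≤ m) :
    ((m + 1 - ∑ i, k i : ℕ) : ℝ) * multinomialWeight k (m + 1) x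
      = (m + 1) * ((1 - ∑ i, |x i|) * multinomialWeight k m x) := by
  obtain ⟨r, hr⟩ := Nat.exists_eq_add_of_le hk
  have e1 : m + 1 - ∑ i, k i = r + 1 := by omega
  have e2 : m - ∑ i, k i = r := by omega
  simp only [multinomialWeight, e1, e2, Nat.factorial_succ]
  have h3 : (∏ j, ((k j).factorial : ℝ)) ≠ 0 :=
    Finset.prod_ne_zero_iff.2 fun j _ => by positivity
  have h4 : (r.factorial : ℝ) ≠ 0 := by positivity
  push_cast
  field_simp
  ring

/-- Size biasing: the factor k_i kills the terms with k_i = 0, and every other k is a shift by the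
i-th unit vector. -/
theorem multinomialMean_mul_coord (f : (Fin d → ℕ) → ℝ) (i : Fin d) :
    multinomialMean x (m + 1) (fun k => k i * f k)
      = (m + 1) * (x i * multinomialMean x m fun k => f (k + Pi.single i 1)) := by
  simp only [multinomialMean, Finset.mul_sum]
  symm
  refine Finset.sum_of_injOn (fun k => k + Pi.single i 1) ?_ ?_ ?_ ?_
  · exact fun a _ b _ h => by simpa using h
  · intro k hk
    simp only [Finset.mem_coe, mem_grid, sum_add_single] at hk ⊢
    omega
  · intro k hk hk'
    have : k i = 0 := by
      by_contra h0
      refine hk' ⟨k - Pi.single i 1, ?_, ?_⟩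
      · have e : k = (k - Pi.single i 1) + Pi.single i 1 := by
          ext j; by_cases hj : j = i
          · subst hj; simp; omega
          · simp [Pi.single_eq_of_ne hj]
        rw [mem_grid, e, sum_add_single] at hk
        simp only [Finset.mem_coe, mem_grid]; omega
      · ext j; by_cases hj : j = i
        · subst hj; simp; omega
        · simp [Pi.single_eq_of_ne hj]
    simp [this]
  · intro k _
    have := multinomialWeight_add_single (x := x) (m := m) k i
    simp only [Pi.add_apply, Pi.single_eq_same]
    linear_combination (-f (k + Pi.single i 1)) * this

/-- Pascal's rule for multinomial means. -/
theorem multinomialMean_succ (f : (Fin d → ℕ) → ℝ) :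
    multinomialMean x (m + 1) f = (1 - ∑ i, |x i|) * multinomialMean x m f
      + ∑ i, x i * multinomialMean x m fun k => f (k + Pi.single i 1) := by
  -- After multiplying by m + 1, split it as (m + 1 − Σk_i) + Σk_i. This is the first part, whose
  -- top layer Σk_i = m + 1 drops out; the second part is `multinomialMean_mul_coord`.
  have h0 : ∑ k ∈ grid d (m + 1), ((m + 1 - ∑ i, k i : ℕ) : ℝ) * f k *
      multinomialWeight k (m + 1) x = (m + 1) * ((1 - ∑ i, |x i|) * multinomialMean x m f) := by
    simp only [multinomialMean, Finset.mul_sum]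
    symm
    refine Finset.sum_of_injOn id (fun a _ b _ h => h) ?_ ?_ ?_
    · intro k hk
      simp only [Finset.mem_coe, mem_grid, id] at hk ⊢; omega
    · intro k hk hk'
      simp only [id, Set.image_id', Finset.mem_coe, mem_grid] at hk hk'
      have : m + 1 - ∑ i, k i = 0 := by omega
      simp [this]
    · intro k hk
      have := multinomialWeight_succ (x := x) (mem_grid.1 hk)
      simp only [id]
      linear_combination (-f k) * this
  have hm : ((m : ℝ) + 1) ≠ 0 := by positivity
  apply mul_left_cancel₀ hm
  rw [mul_add, ← h0, Finset.mul_sum]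
  simp only [← multinomialMean_mul_coord]
  simp only [multinomialMean, Finset.mul_sum]
  rw [Finset.sum_comm, ← Finset.sum_add_distrib]
  refine Finset.sum_congr rfl fun k hk => ?_
  have h1 : ((m + 1 - ∑ i, k i : ℕ) : ℝ) = m + 1 - ∑ i, (k i : ℝ) := by
    rw [Nat.cast_sub (mem_grid.1 hk)]; push_cast; ring
  rw [h1, ← Finset.sum_mul, ← Finset.sum_mul]
  ring

theorem multinomialMean_add (f g : (Fin d → ℕ) → ℝ) :
    multinomialMean x m (fun k => f k + g k) = multinomialMean x m f + multinomialMean x m g := by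
  simp [multinomialMean, add_mul, Finset.sum_add_distrib]

theorem multinomialMean_sub (f g : (Fin d → ℕ) → ℝ) :
    multinomialMean x m (fun k => f k - g k) = multinomialMean x m f - multinomialMean x m g := by
  simp [multinomialMean, sub_mul, Finset.sum_sub_distrib]

theorem multinomialMean_const_mul (c : ℝ) (f : (Fin d → ℕ) → ℝ) :
    multinomialMean x m (fun k => c * f k) = c * multinomialMean x m f := by
  simp [multinomialMean, Finset.mul_sum, mul_assoc]

theorem multinomialMean_mul_const (c : ℝ) (f : (Fin d → ℕ) → ℝ) :
    multinomialMean x m (fun k => f k * c) = multinomialMean x m f * c := by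
  simp_rw [mul_comm _ c, multinomialMean_const_mul]

theorem multinomialMean_sum {ι : Type*} (s : Finset ι) (f : ι → (Fin d → ℕ) → ℝ) :
    multinomialMean x m (fun k => ∑ i ∈ s, f i k) = ∑ i ∈ s, multinomialMean x m (f i) := by
  simp only [multinomialMean, Finset.sum_mul]
  exact Finset.sum_comm

theorem sum_abs_of_mem_simplex (hx : x ∈ simplex d) : ∑ i, |x i| = ∑ i, x i :=
  Finset.sum_congr rfl fun i _ => abs_of_nonneg (hx.1 i).1

theorem multinomialWeight_nonneg (hx : x ∈ simplex d) (k : Fin d → ℕ) :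
    0 ≤ multinomialWeight k m x := by
  unfold multinomialWeight
  have h1 : 0 ≤ 1 - ∑ i, |x i| := by linarith [hx.2]
  have h2 : 0 ≤ ∏ i, x i ^ k i := Finset.prod_nonneg fun i _ => pow_nonneg (hx.1 i).1 _
  have h3 : 0 ≤ ∏ i, ((k i).factorial : ℝ) := Finset.prod_nonneg fun i _ => by positivity
  positivity

theorem multinomialMean_zero (f : (Fin d → ℕ) → ℝ) : multinomialMean x 0 f = f 0 := by
  have : grid d 0 = {0} := by
    ext k; simp [mem_grid, funext_iff]
  simp [multinomialMean, this, multinomialWeight]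

theorem multinomialMean_const (hx : x ∈ simplex d) (c : ℝ) :
    multinomialMean x m (fun _ => c) = c := by
  induction m with
  | zero => simp [multinomialMean_zero]
  | succ m ih =>
    rw [multinomialMean_succ, ih, ← Finset.sum_mul, sum_abs_of_mem_simplex hx]
    ring

theorem multinomialMean_mono (hx : x ∈ simplex d) {f g : (Fin d → ℕ) → ℝ}
    (h : ∀ k ∈ grid d m, f k ≤ g k) : multinomialMean x m f ≤ multinomialMean x m g :=
  Finset.sum_le_sum fun k hk =>
    mul_le_mul_of_nonneg_right (h k hk) (multinomialWeight_nonneg hx k)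

theorem abs_multinomialMean_le (hx : x ∈ simplex d) {f g : (Fin d → ℕ) → ℝ}
    (h : ∀ k ∈ grid d m, |f k| ≤ g k) : |multinomialMean x m f| ≤ multinomialMean x m g := by
  refine (Finset.abs_sum_le_sum_abs _ _).trans (Finset.sum_le_sum fun k hk => ?_)
  rw [abs_mul, abs_of_nonneg (multinomialWeight_nonneg hx k)]
  exact mul_le_mul_of_nonneg_right (h k hk) (multinomialWeight_nonneg hx k)

/-- The last trial hits category i or not, so other categories merge. All moments of one coordinate
follow from this by induction on m. -/
theorem multinomialMean_coord_succ (hx : x ∈ simplex d) (i : Fin d) (f : ℕ → ℝ) :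
    multinomialMean x (m + 1) (fun k => f (k i)) =
      (1 - x i) * multinomialMean x m (fun k => f (k i))
        + x i * multinomialMean x m fun k => f (k i + 1) := by
  rw [multinomialMean_succ, sum_abs_of_mem_simplex hx,
    ← Finset.add_sum_erase _ _ (Finset.mem_univ i), ← Finset.add_sum_erase _ _ (Finset.mem_univ i)]
  have : ∀ j ∈ Finset.univ.erase i, x j * multinomialMean x m
      (fun k => f ((k + Pi.single j 1 : Fin d → ℕ) i)) =
      x j * multinomialMean x m fun k => f (k i) := by
    intro j hj
    simp [Pi.single_eq_of_ne (Finset.ne_of_mem_erase hj).symm]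
  rw [Finset.sum_congr rfl this, ← Finset.sum_mul]
  simp only [Pi.add_apply, Pi.single_eq_same]
  ring

theorem multinomialMean_coord (hx : x ∈ simplex d) (i : Fin d) :
    multinomialMean x m (fun k => (k i : ℝ)) = m * x i := by
  induction m with
  | zero => simp [multinomialMean_zero]
  | succ m ih =>
    rw [multinomialMean_coord_succ hx i (fun n => (n : ℝ))]
    push_cast
    rw [multinomialMean_add, multinomialMean_const hx, ih]
    ring

theorem multinomialMean_coord_sq (hx : x ∈ simplex d) (i : Fin d) :
    multinomialMean x m (fun k => (k i : ℝ) ^ 2) = m * x i * (1 - x i) + (m * x i) ^ 2 := by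
  induction m with
  | zero => simp [multinomialMean_zero]
  | succ m ih =>
    rw [multinomialMean_coord_succ hx i (fun n => (n : ℝ) ^ 2)]
    push_cast
    have : ∀ k : Fin d → ℕ, ((k i : ℝ) + 1) ^ 2 = (k i : ℝ) ^ 2 + (2 * (k i : ℝ) + 1) := by
      intro k; ring
    simp only [this]
    rw [multinomialMean_add, multinomialMean_add, multinomialMean_const_mul,
      multinomialMean_coord hx, multinomialMean_const hx, ih]
    ring

theorem multinomialMean_sq_sub (hx : x ∈ simplex d) (hm : 1 ≤ m) (i : Fin d) :
    multinomialMean x m (fun k => ((k i : ℝ) / m - x i) ^ 2) = x i * (1 - x i) / m := by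
  have hm' : (m : ℝ) ≠ 0 := by positivity
  have : ∀ k : Fin d → ℕ, ((k i : ℝ) / m - x i) ^ 2
      = ((m : ℝ) ^ 2)⁻¹ * (k i : ℝ) ^ 2 + (-(2 * x i / m) * (k i : ℝ) + x i ^ 2) := by
    intro k; field_simp; ring
  simp only [this]
  rw [multinomialMean_add, multinomialMean_add, multinomialMean_const_mul,
    multinomialMean_const_mul, multinomialMean_coord hx, multinomialMean_coord_sq hx,
    multinomialMean_const hx]
  field_simp
  ring

/-- This is |φ(t)|² in real form: the means of cos and sin are squared and added, and each trial
contributes the factor |1 − x_i + x_i e^(it)|² = 1 − 2x_i(1 − x_i)(1 − cos t). -/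
theorem multinomialMean_cos_sub (hx : x ∈ simplex d) (i : Fin d) (t : ℝ) :
    multinomialMean x m (fun k => multinomialMean x m fun l =>
      Real.cos (t * ((k i : ℝ) - l i))) = (1 - 2 * (x i * (1 - x i)) * (1 - Real.cos t)) ^ m := by
  have h1 : ∀ k : Fin d → ℕ, (multinomialMean x m fun l => Real.cos (t * ((k i : ℝ) - l i)))
      = Real.cos (t * k i) * multinomialMean x m (fun l => Real.cos (t * l i))
        + Real.sin (t * k i) * multinomialMean x m (fun l => Real.sin (t * l i)) := by
    intro k
    simp only [mul_sub, Real.cos_sub]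
    rw [multinomialMean_add, multinomialMean_const_mul, multinomialMean_const_mul]
  simp only [h1]
  rw [multinomialMean_add, multinomialMean_mul_const, multinomialMean_mul_const]
  induction m with
  | zero => simp [multinomialMean_zero]
  | succ m ih =>
    have ih := ih (fun k => by
      simp only [mul_sub, Real.cos_sub]
      rw [multinomialMean_add, multinomialMean_const_mul, multinomialMean_const_mul])
    rw [multinomialMean_coord_succ hx i (fun n => Real.cos (t * n)),
      multinomialMean_coord_succ hx i (fun n => Real.sin (t * n))]
    push_cast
    simp only [mul_add, mul_one, Real.cos_add, Real.sin_add]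
    rw [multinomialMean_sub, multinomialMean_add, multinomialMean_mul_const,
      multinomialMean_mul_const, multinomialMean_mul_const, multinomialMean_mul_const,
      pow_succ, ← ih]
    have := Real.sin_sq_add_cos_sq t
    linear_combination (x i ^ 2 * (multinomialMean x m (fun k => Real.cos (t * k i)) ^ 2
      + multinomialMean x m (fun k => Real.sin (t * k i)) ^ 2)) * this

theorem multinomialMean_coord_eq (hx : x ∈ simplex d) (i : Fin d) (j : ℕ) :
    multinomialMean x m (fun k => if k i = j then 1 else 0)
      = (m.choose j : ℝ) * x i ^ j * (1 - x i) ^ (m - j) := by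
  induction m generalizing j with
  | zero =>
    cases j <;> simp [multinomialMean_zero]
  | succ m ih =>
    rw [multinomialMean_coord_succ hx i (fun n => if n = j then 1 else 0), ih]
    cases j with
    | zero =>
      simp [multinomialMean_const hx, pow_succ]
      ring
    | succ j =>
      simp only [Nat.add_right_cancel_iff]
      rw [ih, Nat.choose_succ_succ]
      rcases lt_or_ge j m with h | h
      · obtain ⟨r, rfl⟩ := Nat.exists_eq_add_of_lt h
        have e1 : j + r + 1 - (j + 1) = r := by omega
        have e2 : j + r + 1 - j = r + 1 := by omega
        have e3 : j + r + 1 + 1 - (j + 1) = r + 1 := by omega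
        rw [e1, e2, e3]
        push_cast; ring
      -- For `j ≥ m` both truncated exponents are 0, and the spurious term is killed by its binomial
      -- coefficient.
      · have e1 : m - j = 0 := by omega
        have e3 : m + 1 - (j + 1) = 0 := by omega
        rw [Nat.choose_eq_zero_of_lt (by omega : m < j + 1), e1, e3]
        push_cast; ring

theorem multinomialMean_comp_coord (hx : x ∈ simplex d) (i : Fin d) (f : ℕ → ℝ) :
    multinomialMean x m (fun k => f (k i)) = ∑ j ∈ Finset.range (m + 1),
      (m.choose j : ℝ) * x i ^ j * (1 - x i) ^ (m - j) * f j := by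
  simp only [← multinomialMean_coord_eq hx i]
  simp only [← multinomialMean_mul_const, ← multinomialMean_sum]
  refine Finset.sum_congr rfl fun k hk => ?_
  have : k i ≤ m := (Finset.single_le_sum (f := k) (fun _ _ => Nat.zero_le _)
    (Finset.mem_univ i)).trans (mem_grid.1 hk)
  simp [Nat.lt_succ_of_le this]

theorem div_mem_simplex (hm : 1 ≤ m) {k : Fin d → ℕ} (hk : ∑ i, k i ≤ m) :
    (fun i => (k i : ℝ) / m) ∈ simplex d := by
  have hm' : (0 : ℝ) < m := by positivity
  refine ⟨fun i => ⟨by positivity, ?_⟩, ?_⟩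
  · rw [div_le_one hm']
    exact_mod_cast (Finset.single_le_sum (f := k) (fun _ _ => Nat.zero_le _)
      (Finset.mem_univ i)).trans hk
  · have : ∀ i, |(k i : ℝ) / m| = (k i : ℝ) / m := fun i => abs_of_nonneg (by positivity)
    simp only [this, ← Finset.sum_div]
    rw [div_le_one hm']
    exact_mod_cast hk

end Multinomial

/-! ### Geometry of the simplex and Taylor bounds up to its boundary -/

section Calculus

variable {d : ℕ}

theorem convex_simplex : Convex ℝ (simplex d) := by
  have : simplex d = (Set.univ.pi fun _ => Set.Icc (0 : ℝ) 1) ∩ {x | ∑ i, |x i| ≤ 1} := by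
    ext x; simp only [simplex, Set.mem_inter_iff, Set.mem_univ_pi, Set.mem_ofPred_eq]
  rw [this]
  refine (convex_pi fun i _ => convex_Icc _ _).inter ?_
  intro x hx y hy a b ha hb hab
  simp only [Set.mem_ofPred_eq] at hx hy ⊢
  calc ∑ i, |(a • x + b • y) i| ≤ ∑ i, (a * |x i| + b * |y i|) := by
        refine Finset.sum_le_sum fun i _ => ?_
        simp only [Pi.add_apply, Pi.smul_apply, smul_eq_mul]
        refine (abs_add_le _ _).trans ?_
        rw [abs_mul, abs_mul, abs_of_nonneg ha, abs_of_nonneg hb]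
    _ = a * ∑ i, |x i| + b * ∑ i, |y i| := by
        rw [Finset.sum_add_distrib, Finset.mul_sum, Finset.mul_sum]
    _ ≤ 1 := by nlinarith

theorem isCompact_simplex : IsCompact (simplex d) := by
  refine (isCompact_Icc (a := (0 : Fin d → ℝ)) (b := 1)).of_isClosed_subset ?_ ?_
  · have : simplex d = {x : Fin d → ℝ | ∀ i, x i ∈ Set.Icc (0 : ℝ) 1} ∩ {x | ∑ i, |x i| ≤ 1} :=
      rfl
    rw [this]
    refine IsClosed.inter ?_ (isClosed_le (by fun_prop) continuous_const)
    simp only [Set.ofPred_forall]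
    exact isClosed_iInter fun i => isClosed_Icc.preimage (continuous_apply i)
  · intro x hx
    exact ⟨fun i => (hx.1 i).1, fun i => (hx.1 i).2⟩

/-- Convexity and nonempty interior suffice. Without unique differentiability the derivatives within
the simplex would not be determined at boundary points. -/
theorem uniqueDiffOn_simplex : UniqueDiffOn ℝ (simplex d) := by
  refine uniqueDiffOn_convex convex_simplex ?_
  have ho : IsOpen {x : Fin d → ℝ | (∀ i, 0 < x i) ∧ ∑ i, x i < 1} := by
    have h1 : IsOpen {x : Fin d → ℝ | ∑ i, x i < 1} := isOpen_lt (by fun_prop) continuous_const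
    have h2 : IsOpen {x : Fin d → ℝ | ∀ i, 0 < x i} := by
      simp only [Set.ofPred_forall]
      exact isOpen_iInter_of_finite fun i => isOpen_lt continuous_const (continuous_apply i)
    exact h2.inter h1
  have hs : {x : Fin d → ℝ | (∀ i, 0 < x i) ∧ ∑ i, x i < 1} ⊆ simplex d := by
    rintro x ⟨h0, h1⟩
    refine ⟨fun i => ⟨(h0 i).le, ?_⟩, ?_⟩
    · exact (Finset.single_le_sum (fun j _ => (h0 j).le) (Finset.mem_univ i)).trans h1.le
    · simpa only [abs_of_pos (h0 _)] using h1.le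
  -- The barycentre: each coordinate and the slack 1 − Σx_i equal 1/(d+1).
  refine ⟨fun _ => 1 / ((d : ℝ) + 1), interior_maximal hs ho ⟨fun i => by positivity, ?_⟩⟩
  have : (0 : ℝ) < d + 1 := by positivity
  simp only [Finset.sum_const, Finset.card_univ, Fintype.card_fin, nsmul_eq_mul]
  rw [mul_one_div, div_lt_one this]
  linarith

/-- A continuously differentiable function on a compact convex set is Lipschitz there. -/
theorem exists_lipschitz_of_contDiffOn {E G : Type*} [NormedAddCommGroup E] [NormedSpace ℝ E]
    [NormedAddCommGroup G] [NormedSpace ℝ G] {s : Set E} {f : E → G} (hf : ContDiffOn ℝ 1 f s)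
    (hc : IsCompact s) (hs : Convex ℝ s) (hu : UniqueDiffOn ℝ s) :
    ∃ C : ℝ, 0 ≤ C ∧ ∀ x ∈ s, ∀ y ∈ s, ‖f y - f x‖ ≤ C * ‖y - x‖ := by
  obtain ⟨C, hC⟩ := hc.exists_bound_of_continuousOn (hf.continuousOn_fderivWithin hu le_rfl)
  refine ⟨max C 0, le_max_right _ _, fun x hx y hy => ?_⟩
  exact hs.norm_image_sub_le_of_norm_fderivWithin_le (hf.differentiableOn one_ne_zero)
    (fun z hz => (hC z hz).trans (le_max_left _ _)) hx hy

/-- First-order Taylor expansion with a uniform quadratic remainder. -/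
theorem exists_taylor_of_contDiffOn {E G : Type*} [NormedAddCommGroup E] [NormedSpace ℝ E]
    [NormedAddCommGroup G] [NormedSpace ℝ G] {s : Set E} {f : E → G} (hf : ContDiffOn ℝ 2 f s)
    (hc : IsCompact s) (hs : Convex ℝ s) (hu : UniqueDiffOn ℝ s) :
    ∃ C : ℝ, 0 ≤ C ∧ ∀ x ∈ s, ∀ y ∈ s,
      ‖f y - f x - fderivWithin ℝ f s x (y - x)‖ ≤ C * ‖y - x‖ ^ 2 := by
  obtain ⟨C, hC0, hC⟩ := exists_lipschitz_of_contDiffOn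
    (hf.fderivWithin (m := 1) hu (by norm_num)) hc hs hu
  refine ⟨C, hC0, fun x hx y hy => ?_⟩
  have hseg : segment ℝ x y ⊆ s := hs.segment_subset hx hy
  -- Mean value inequality along the segment: there the derivative deviates from its value at x by
  -- at most C‖y − x‖, which supplies the second factor ‖y − x‖.
  have := (convex_segment (𝕜 := ℝ) x y).norm_image_sub_le_of_norm_hasFDerivWithin_le'
    (f := f) (f' := fderivWithin ℝ f s) (φ := fderivWithin ℝ f s x) (C := C * ‖y - x‖)
    (fun z hz => ((hf.differentiableOn two_ne_zero) z (hseg hz)).hasFDerivWithinAt.mono hseg)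
    (fun z hz => (hC x hx z (hseg hz)).trans
      (mul_le_mul_of_nonneg_left (norm_sub_le_of_mem_segment hz) hC0))
    (left_mem_segment ℝ x y) (right_mem_segment ℝ x y)
  rwa [mul_assoc, ← sq] at this

theorem fderivWithin_apply_eq_sum (G : (Fin d → ℝ) → ℝ) (x v : Fin d → ℝ) :
    fderivWithin ℝ G (simplex d) x v = ∑ i, partialDeriv G i x * v i := by
  conv_lhs => rw [pi_eq_sum_univ' v]
  rw [map_sum]
  refine Finset.sum_congr rfl fun i _ => ?_
  rw [map_smul, smul_eq_mul, mul_comm]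
  congr 2

theorem norm_sq_le_sum_sq (v : Fin d → ℝ) : ‖v‖ ^ 2 ≤ ∑ i, v i ^ 2 := by
  rw [← Real.le_sqrt (norm_nonneg _) (Finset.sum_nonneg fun i _ => sq_nonneg _)]
  refine (pi_norm_le_iff_of_nonneg (Real.sqrt_nonneg _)).2 fun i => ?_
  rw [Real.norm_eq_abs]
  refine Real.abs_le_sqrt (Finset.single_le_sum (f := fun i => v i ^ 2) (fun j _ => sq_nonneg _)
    (Finset.mem_univ i))

theorem exists_taylor_simplex {F : (Fin d → ℝ) → ℝ} (hF : ContDiffOn ℝ 3 F (simplex d)) :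
    ∃ C : ℝ, 0 ≤ C ∧ ∀ x ∈ simplex d, ∀ y ∈ simplex d,
      |F y - F x - ∑ i, partialDeriv F i x * (y i - x i)| ≤ C * ∑ i, (y i - x i) ^ 2 := by
  obtain ⟨C, hC0, hC⟩ := exists_taylor_of_contDiffOn (hF.of_le (by norm_num)) isCompact_simplex
    convex_simplex uniqueDiffOn_simplex
  refine ⟨C, hC0, fun x hx y hy => ?_⟩
  have := hC x hx y hy
  rw [fderivWithin_apply_eq_sum, Real.norm_eq_abs] at this
  exact this.trans (mul_le_mul_of_nonneg_left (norm_sq_le_sum_sq (y - x)) hC0)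

theorem exists_lipschitz_simplex {F : (Fin d → ℝ) → ℝ} (hF : ContDiffOn ℝ 3 F (simplex d)) :
    ∃ C : ℝ, 0 ≤ C ∧ ∀ x ∈ simplex d, ∀ y ∈ simplex d, |F y - F x| ≤ C * ‖y - x‖ := by
  obtain ⟨C, hC0, hC⟩ := exists_lipschitz_of_contDiffOn (hF.of_le (by norm_num)) isCompact_simplex
    convex_simplex uniqueDiffOn_simplex
  exact ⟨C, hC0, hC⟩

/-- A function vanishing on the coordinate faces has vanishing tangential derivatives there. -/
theorem partialDeriv_eq_zero_of_face {F : (Fin d → ℝ) → ℝ} (hF : ContDiffOn ℝ 3 F (simplex d))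
    (hface : ∀ x ∈ simplex d, (∃ i, x i = 0) → F x = 0) {z : Fin d → ℝ} (hz : z ∈ simplex d)
    {i j : Fin d} (hij : j ≠ i) (hj : z j = 0) (hsum : ∑ k, |z k| < 1) :
    partialDeriv F i z = 0 := by
  -- The slack δ leaves room to move from z in direction i while staying in the simplex and on the
  -- face x_j = 0. There F is constantly 0, so uniqueness of the one-sided derivative on [0, δ]
  -- concludes.
  set δ : ℝ := 1 - ∑ k, |z k| with hδ
  have hδ0 : 0 < δ := by linarith
  have hmem : ∀ t ∈ Set.Icc (0 : ℝ) δ, z + t • Pi.single i 1 ∈ simplex d := by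
    intro t ht
    have hnn : ∀ k, 0 ≤ (z + t • Pi.single i (1 : ℝ) : Fin d → ℝ) k := by
      intro k
      have h1 := (hz.1 k).1
      have h2 : 0 ≤ t * (Pi.single i (1 : ℝ) : Fin d → ℝ) k :=
        mul_nonneg ht.1 (by by_cases h : k = i <;> simp [h])
      simpa using add_nonneg h1 h2
    have hs : ∑ k, |(z + t • Pi.single i (1 : ℝ) : Fin d → ℝ) k| ≤ 1 := by
      simp only [abs_of_nonneg (hnn _)]
      have := ht.2
      rw [hδ, sum_abs_of_mem_simplex hz] at this
      simp only [Pi.add_apply, Pi.smul_apply, smul_eq_mul, Finset.sum_add_distrib,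
        ← Finset.mul_sum, Finset.sum_pi_single', Finset.mem_univ, if_true, mul_one]
      linarith
    refine ⟨fun k => ⟨hnn k, ?_⟩, hs⟩
    refine le_trans (le_abs_self _) (le_trans ?_ hs)
    exact Finset.single_le_sum (f := fun k => |(z + t • Pi.single i (1 : ℝ) : Fin d → ℝ) k|)
      (fun _ _ => abs_nonneg _) (Finset.mem_univ k)
  have hline : HasDerivWithinAt (fun t : ℝ => z + t • (Pi.single i (1 : ℝ) : Fin d → ℝ))
      (Pi.single i 1) (Set.Icc 0 δ) 0 := by
    have := ((hasDerivAt_id (0 : ℝ)).smul_const (Pi.single i (1 : ℝ) : Fin d → ℝ)).const_add z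
    simpa using this.hasDerivWithinAt
  have hd : HasFDerivWithinAt F (fderivWithin ℝ F (simplex d) z) (simplex d)
      (z + (0 : ℝ) • (Pi.single i (1 : ℝ) : Fin d → ℝ)) := by
    simpa using ((hF.differentiableOn (by norm_num)) z hz).hasFDerivWithinAt
  have h1 := hd.comp_hasDerivWithinAt (0 : ℝ) hline hmem
  have h2 : HasDerivWithinAt (F ∘ fun t : ℝ => z + t • (Pi.single i (1 : ℝ) : Fin d → ℝ)) 0
      (Set.Icc 0 δ) 0 := by
    refine (hasDerivWithinAt_const (0 : ℝ) (Set.Icc 0 δ) (0 : ℝ)).congr_of_mem (fun t ht => ?_)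
      ⟨le_rfl, hδ0.le⟩
    exact hface _ (hmem t ht) ⟨j, by simp [hj, Pi.single_eq_of_ne hij]⟩
  exact (uniqueDiffOn_Icc hδ0 0 ⟨le_rfl, hδ0.le⟩).eq_deriv _ h1 h2

end Calculus

/-! ### Reduction of the variance to multinomial means of the c.d.f. -/

section Variance

variable {d : ℕ}

/-- The weight that the Bernstein estimator gives to an observation at `z`. -/
noncomputable def bernsteinKernel (m : ℕ) (x z : Fin d → ℝ) : ℝ :=
  multinomialMean x m fun k =>
    (Set.Iic fun i => (k i : ℝ) / m).indicator (fun _ => (1 : ℝ)) z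

/-- The variance of `bernsteinKernel m x` under a distribution with c.d.f. `F`. -/
noncomputable def kernelVariance (F : (Fin d → ℝ) → ℝ) (m : ℕ) (x : Fin d → ℝ) : ℝ :=
  multinomialMean x m (fun k => multinomialMean x m fun l =>
    F fun i => ((min (k i) (l i) : ℕ) : ℝ) / m)
    - (multinomialMean x m fun k => F fun i => (k i : ℝ) / m) ^ 2

variable {m : ℕ} {x : Fin d → ℝ}

theorem bernsteinEstimator_eq {n : ℕ} (obs : Fin n → Fin d → ℝ) :
    bernsteinEstimator obs m x = (n : ℝ)⁻¹ * ∑ j, bernsteinKernel m x (obs j) := by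
  simp only [bernsteinKernel]
  rw [← multinomialMean_sum, ← multinomialMean_const_mul]
  rfl

theorem measurable_bernsteinKernel : Measurable (bernsteinKernel m x) := by
  unfold bernsteinKernel multinomialMean
  refine Finset.measurable_sum _ fun k _ => Measurable.mul_const ?_ _
  exact measurable_const.indicator measurableSet_Iic

theorem abs_bernsteinKernel_le (z : Fin d → ℝ) :
    |bernsteinKernel m x z| ≤ ∑ k ∈ grid d m, |multinomialWeight k m x| := by
  refine (Finset.abs_sum_le_sum_abs _ _).trans (Finset.sum_le_sum fun k _ => ?_)
  rw [abs_mul]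
  refine mul_le_of_le_one_left (abs_nonneg _) ?_
  by_cases h : z ∈ Set.Iic (fun i => (k i : ℝ) / m) <;> simp [h]

theorem integrable_multinomialMean {α : Type*} [MeasurableSpace α] {ν : Measure α}
    {f : (Fin d → ℕ) → α → ℝ} (hf : ∀ k, Integrable (f k) ν) :
    Integrable (fun z => multinomialMean x m fun k => f k z) ν :=
  integrable_finsetSum _ fun k _ => (hf k).mul_const _

theorem integral_multinomialMean {α : Type*} [MeasurableSpace α] {ν : Measure α}
    {f : (Fin d → ℕ) → α → ℝ} (hf : ∀ k, Integrable (f k) ν) :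
    ∫ z, multinomialMean x m (fun k => f k z) ∂ν = multinomialMean x m fun k => ∫ z, f k z ∂ν := by
  unfold multinomialMean
  rw [integral_finsetSum _ fun k _ => (hf k).mul_const _]
  simp only [integral_mul_const]

variable (μ : Measure (Fin d → ℝ))

theorem integral_indicator_Iic (a : Fin d → ℝ) :
    ∫ z, (Set.Iic a).indicator (fun _ => (1 : ℝ)) z ∂μ = jointCDF μ a := by
  rw [integral_indicator_const _ measurableSet_Iic]
  simp [jointCDF]

variable [IsProbabilityMeasure μ]

theorem memLp_bernsteinKernel : MemLp (bernsteinKernel m x) 2 μ :=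
  MemLp.of_bound measurable_bernsteinKernel.aestronglyMeasurable _
    (Filter.Eventually.of_forall fun z => abs_bernsteinKernel_le z)

theorem integrable_indicator_Iic (a : Fin d → ℝ) :
    Integrable ((Set.Iic a).indicator fun _ => (1 : ℝ)) μ :=
  (integrable_const 1).indicator measurableSet_Iic

/-- The square of a multinomial mean is a double mean over independent copies, and the orthants
below k/m and l/m intersect in the one below their minimum. Integrating the indicators yields the
c.d.f. -/
theorem variance_bernsteinKernel :
    variance (bernsteinKernel m x) μ = kernelVariance (jointCDF μ) m x := by
  rw [variance_eq_sub (memLp_bernsteinKernel μ), kernelVariance]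
  congr 2
  · have h : ∀ z, bernsteinKernel m x z ^ 2 = multinomialMean x m fun k => multinomialMean x m
        fun l => (Set.Iic fun i => ((min (k i) (l i) : ℕ) : ℝ) / m).indicator
          (fun _ => (1 : ℝ)) z := by
      intro z
      rw [sq]
      nth_rewrite 1 [bernsteinKernel]
      rw [← multinomialMean_mul_const]
      congr 1
      ext k
      rw [bernsteinKernel, ← multinomialMean_const_mul]
      congr 1
      ext l
      have : (Set.Iic fun i => ((min (k i) (l i) : ℕ) : ℝ) / m)
          = (Set.Iic fun i => (k i : ℝ) / m) ∩ (Set.Iic fun i => (l i : ℝ) / m) := by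
        rw [Set.Iic_inter_Iic]
        congr 1
        ext i
        simp only [Pi.inf_apply, Nat.cast_min]
        exact (min_div_div_right (Nat.cast_nonneg m) _ _).symm
      rw [this]
      rw [← Set.inter_indicator_mul, mul_one]
    simp only [Pi.pow_apply, h]
    rw [integral_multinomialMean]
    · congr 1
      ext k
      rw [integral_multinomialMean]
      · simp only [integral_indicator_Iic]
      · exact fun l => integrable_indicator_Iic μ _
    · exact fun k => integrable_multinomialMean fun l => integrable_indicator_Iic μ _
  · unfold bernsteinKernel
    rw [integral_multinomialMean]
    · simp only [integral_indicator_Iic]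
    · exact fun l => integrable_indicator_Iic μ _

theorem variance_bernsteinEstimator {n : ℕ} {Ω : Type*} [MeasurableSpace Ω]
    (P : Measure Ω) [IsProbabilityMeasure P] (X : Fin n → Ω → Fin d → ℝ)
    (hX : ∀ j, HasLaw (X j) μ P) (hind : iIndepFun X P) :
    variance (fun ω => bernsteinEstimator (fun j => X j ω) m x) P
      = (n : ℝ)⁻¹ * kernelVariance (jointCDF μ) m x := by
  -- With no observations both sides are 0, because `0⁻¹ = 0`.
  rcases Nat.eq_zero_or_pos n with rfl | hn
  · simp only [bernsteinEstimator_eq, Finset.univ_eq_empty, Finset.sum_empty, CharP.cast_eq_zero,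
      inv_zero, zero_mul]
    exact variance_zero P
  have hn' : (n : ℝ) ≠ 0 := by positivity
  have hm : Measurable (bernsteinKernel m x) := measurable_bernsteinKernel
  have hvar : ∀ j, variance (bernsteinKernel m x ∘ X j) P = kernelVariance (jointCDF μ) m x := by
    intro j
    rw [← variance_bernsteinKernel μ, ← (hX j).map_eq,
      variance_map hm.aemeasurable (hX j).aemeasurable]
  simp only [bernsteinEstimator_eq]
  rw [variance_const_mul]
  have hs : (fun ω => ∑ j, bernsteinKernel m x (X j ω)) = ∑ j, bernsteinKernel m x ∘ X j := by
    ext ω; simp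
  rw [hs, IndepFun.variance_sum]
  · simp only [hvar, Finset.sum_const, Finset.card_univ, Fintype.card_fin, nsmul_eq_mul]
    field_simp
  · intro j _
    have h := memLp_bernsteinKernel (m := m) (x := x) μ
    rw [← (hX j).map_eq] at h
    exact h.comp_of_map (hX j).aemeasurable
  · intro i _ j _ hij
    exact (hind.indepFun hij).comp hm hm

theorem kernelVariance_nonneg : 0 ≤ kernelVariance (jointCDF μ) m x := by
  rw [← variance_bernsteinKernel]
  exact variance_nonneg _ _

theorem jointCDF_mono : Monotone (jointCDF μ) := fun _ _ h =>
  measureReal_mono (Set.Iic_subset_Iic.2 h)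

/-- Drop the squared mean and use F(K∧L) ≤ F(K). -/
theorem kernelVariance_le (hx : x ∈ simplex d) :
    kernelVariance (jointCDF μ) m x
      ≤ multinomialMean x m fun k => jointCDF μ fun i => (k i : ℝ) / m := by
  refine (sub_le_self _ (sq_nonneg _)).trans (multinomialMean_mono hx fun k _ => ?_)
  calc _ ≤ multinomialMean x m fun _ => jointCDF μ fun i => (k i : ℝ) / m := by
        refine multinomialMean_mono hx fun l _ => jointCDF_mono μ fun i => ?_
        have : ((min (k i) (l i) : ℕ) : ℝ) ≤ k i := by exact_mod_cast min_le_left _ _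
        gcongr
    _ = _ := multinomialMean_const hx _

/-- If k_i > 0 the weight contains a positive power of x_i = 0. If k_i = 0 the orthant below k/m is
null, since F vanishes on the face. -/
theorem bernsteinEstimator_eq_zero (hm : 1 ≤ m) (hx : ∃ i, x i = 0)
    (hface : ∀ x ∈ simplex d, (∃ i, x i = 0) → jointCDF μ x = 0)
    {n : ℕ} {Ω : Type*} [MeasurableSpace Ω] (P : Measure Ω) (X : Fin n → Ω → Fin d → ℝ)
    (hX : ∀ j, HasLaw (X j) μ P) :
    ∀ᵐ ω ∂P, bernsteinEstimator (fun j => X j ω) m x = 0 := by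
  obtain ⟨i, hi⟩ := hx
  have h : ∀ᵐ z ∂μ, bernsteinKernel m x z = 0 := by
    have h1 : ∀ᵐ z ∂μ, ∀ k ∈ {k | k ∈ grid d m ∧ k i = 0},
        z ∉ Set.Iic (fun i => (k i : ℝ) / m) := by
      refine (ae_ball_iff (Set.to_countable _)).2 fun k hk => ?_
      have := hface _ (div_mem_simplex hm (mem_grid.1 hk.1)) ⟨i, by simp [hk.2]⟩
      rw [jointCDF, measureReal_eq_zero_iff] at this
      exact measure_eq_zero_iff_ae_notMem.1 this
    filter_upwards [h1] with z hz
    refine Finset.sum_eq_zero fun k hk => ?_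
    by_cases h0 : k i = 0
    · simp [hz k ⟨hk, h0⟩]
    · have : multinomialWeight k m x = 0 := by
        rw [multinomialWeight,
          Finset.prod_eq_zero (f := fun i => x i ^ k i) (Finset.mem_univ i) (by simp [hi, h0]),
          mul_zero]
      simp [this]
  have h2 : ∀ᵐ ω ∂P, ∀ j, bernsteinKernel m x (X j ω) = 0 := by
    rw [ae_all_iff]
    intro j
    rw [← (hX j).map_eq] at h
    exact ae_of_ae_map (hX j).aemeasurable h
  filter_upwards [h2] with ω hω
  simp [bernsteinEstimator_eq, hω]

end Variance

/-! ### Poisson approximation of binomial marginals, with rate 1/m -/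

section Poisson

/-- The probability of the value `k` under the Poisson distribution with mean `r`. -/
noncomputable def poissonWeight (r : ℝ) (k : ℕ) : ℝ := Real.exp (-r) * (r ^ k / k.factorial)

variable {r : ℝ}

theorem poissonWeight_nonneg (hr : 0 ≤ r) (k : ℕ) : 0 ≤ poissonWeight r k := by
  unfold poissonWeight; positivity

theorem hasSum_poissonWeight : HasSum (poissonWeight r) 1 := by
  have := (NormedSpace.expSeries_div_hasSum_exp r).mul_left (Real.exp (-r))
  rwa [← Real.exp_eq_exp_ℝ, ← Real.exp_add, neg_add_cancel, Real.exp_zero] at this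

theorem succ_mul_poissonWeight (k : ℕ) :
    ((k + 1 : ℕ) : ℝ) * poissonWeight r (k + 1) = r * poissonWeight r k := by
  unfold poissonWeight
  rw [Nat.factorial_succ]
  have : ((k : ℝ) + 1) ≠ 0 := by positivity
  push_cast
  field_simp
  ring

/-- The bound k^j ≤ j! e^k reduces the series to the exponential series at |r|e. -/
theorem summable_poissonWeight_mul_pow (j : ℕ) :
    Summable fun k : ℕ => poissonWeight r k * (k : ℝ) ^ j := by
  have h : Summable fun k : ℕ => |r| ^ k / (k.factorial : ℝ) * (k : ℝ) ^ j := by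
    have h2 : ∀ k : ℕ, |r| ^ k / (k.factorial : ℝ) * (k : ℝ) ^ j
        ≤ j.factorial * ((|r| * Real.exp 1) ^ k / k.factorial) := by
      intro k
      have h3 : (k : ℝ) ^ j ≤ j.factorial * Real.exp k := by
        have := Real.pow_div_factorial_le_exp (k : ℝ) (Nat.cast_nonneg k) j
        rwa [div_le_iff₀' (by positivity)] at this
      rw [mul_pow, ← Real.exp_nat_mul, mul_one]
      calc |r| ^ k / (k.factorial : ℝ) * (k : ℝ) ^ j
          ≤ |r| ^ k / (k.factorial : ℝ) * (j.factorial * Real.exp k) := by gcongr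
        _ = _ := by ring
    exact Summable.of_nonneg_of_le (fun k => by positivity) h2
      ((NormedSpace.expSeries_div_summable (|r| * Real.exp 1)).mul_left _)
  refine Summable.of_norm_bounded (h.mul_left (Real.exp (-r))) fun k => ?_
  rw [poissonWeight, norm_mul, norm_mul, norm_div, norm_pow, norm_pow]
  simp only [Real.norm_eq_abs, Nat.abs_cast, Real.abs_exp]
  exact le_of_eq (by ring)

theorem summable_poissonWeight_mul (hr : 0 ≤ r) {f : ℕ → ℝ} (hf : ∀ k, |f k| ≤ k) :
    Summable fun k => poissonWeight r k * f k := by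
  refine Summable.of_norm_bounded (summable_poissonWeight_mul_pow (r := r) 1) fun k => ?_
  rw [norm_mul, Real.norm_eq_abs, Real.norm_eq_abs, abs_of_nonneg (poissonWeight_nonneg hr k),
    pow_one]
  exact mul_le_mul_of_nonneg_left (hf k) (poissonWeight_nonneg hr k)

/-- The ratio is the product of 1 − j/m over j < k. In the induction, the factor 1 − k/m costs at
most k/m, less than the available (2k+1)/m. -/
theorem one_sub_sq_div_le_descFactorial_div {m k : ℕ} (hm : 1 ≤ m) (hk : k ≤ m) :
    1 - (k : ℝ) ^ 2 / m ≤ (m.descFactorial k : ℝ) / (m : ℝ) ^ k := by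
  have hm' : (0 : ℝ) < m := by positivity
  induction k with
  | zero => simp
  | succ k ih =>
    have ih := ih (by omega)
    rw [Nat.descFactorial_succ, Nat.cast_mul, Nat.cast_sub (by omega),
      pow_succ (m : ℝ)]
    have hk' : (k : ℝ) ≤ m := by exact_mod_cast (by omega : k ≤ m)
    have e : ((m : ℝ) - k) * (m.descFactorial k : ℝ) / ((m : ℝ) ^ k * m)
        = (1 - k / m) * ((m.descFactorial k : ℝ) / (m : ℝ) ^ k) := by
      field_simp
    rw [e]
    have h1 : (k : ℝ) / m ≤ 1 := by rwa [div_le_one hm']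
    refine le_trans ?_ (mul_le_mul_of_nonneg_left ih (by linarith))
    have h2 : 0 ≤ (k : ℝ) / m * ((k : ℝ) ^ 2 / m) := by positivity
    have h3 : (((k + 1 : ℕ) : ℝ)) ^ 2 / m = (k : ℝ) ^ 2 / m + 2 * (k / m) + 1 / m := by
      push_cast; ring
    have h4 : 0 ≤ (1 : ℝ) / m := by positivity
    have h5 : 0 ≤ (k : ℝ) / m := by positivity
    rw [h3]
    nlinarith

/-- A pointwise form of the Poisson approximation of the binomial distribution. -/
theorem abs_binomial_sub_poissonWeight_le (hr : 0 ≤ r) {m : ℕ} (hm : 1 ≤ m) (hrm : r ≤ m)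
    (k : ℕ) :
    |(m.choose k : ℝ) * (r / m) ^ k * (1 - r / m) ^ (m - k) - poissonWeight r k|
      ≤ poissonWeight r k * ((k : ℝ) ^ 2 + r ^ 2 + r * Real.exp r * k) / m := by
  have hm' : (0 : ℝ) < m := by positivity
  have hp0 := poissonWeight_nonneg hr k
  -- Beyond the binomial range the difference is the Poisson weight itself, and k² ≥ m makes the
  -- bound trivial.
  rcases lt_or_ge m k with hk | hk
  · rw [Nat.choose_eq_zero_of_lt hk]
    simp only [Nat.cast_zero, zero_mul, zero_sub, abs_neg, abs_of_nonneg hp0]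
    rw [mul_div_assoc]
    refine le_mul_of_one_le_right hp0 ?_
    rw [one_le_div hm']
    have h1 : (m : ℝ) ≤ k := by exact_mod_cast hk.le
    have h2 : (1 : ℝ) ≤ m := by exact_mod_cast hm
    have h3 : 0 ≤ r * Real.exp r * k := by positivity
    nlinarith [sq_nonneg r]
  -- The ratio of the binomial to the Poisson weight is D·E. It remains to show 1 − k²/m ≤ D ≤ 1 and
  -- 1 − r²/m ≤ E ≤ 1 + r e^r k/m.
  set D : ℝ := (m.descFactorial k : ℝ) / (m : ℝ) ^ k with hD
  set E : ℝ := (1 - r / m) ^ (m - k) * Real.exp r with hE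
  have hb : (m.choose k : ℝ) * (r / m) ^ k * (1 - r / m) ^ (m - k)
      = poissonWeight r k * (D * E) := by
    rw [hD, hE, poissonWeight, Nat.choose_eq_descFactorial_div_factorial,
      Nat.cast_div (Nat.factorial_dvd_descFactorial _ _) (by positivity), div_pow, Real.exp_neg]
    have := Real.exp_ne_zero r
    field_simp
  have hq0 : 0 ≤ 1 - r / m := by
    have : r / m ≤ 1 := by rwa [div_le_one hm']
    linarith
  have hq1 : 1 - r / m ≤ 1 := by
    have : 0 ≤ r / m := by positivity
    linarith
  have hE0 : 0 ≤ E := by positivity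
  have hD0 : 0 ≤ D := by positivity
  have hD1 : D ≤ 1 := by
    rw [hD, div_le_one (by positivity)]
    exact_mod_cast Nat.descFactorial_le_pow m k
  have hDl : 1 - (k : ℝ) ^ 2 / m ≤ D := one_sub_sq_div_le_descFactorial_div hm hk
  -- With u = r/m, (1 − u)e^u ≥ 1 − u²; raise to the power m and apply Bernoulli's inequality.
  have hEl : 1 - r ^ 2 / m ≤ E := by
    have h1 : 1 - (r / m) ^ 2 ≤ (1 - r / m) * Real.exp (r / m) := by
      have := Real.add_one_le_exp (r / m)
      nlinarith
    have h2 : (r / m) ^ 2 ≤ 1 := by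
      rw [sq_le_one_iff₀ (by positivity)]; linarith
    have h3 : 1 - r ^ 2 / m ≤ (1 - (r / m) ^ 2) ^ m := by
      have := one_add_mul_le_pow (a := -(r / m) ^ 2) (by linarith) m
      have e : (m : ℝ) * -(r / m) ^ 2 = - (r ^ 2 / m) := by field_simp
      rw [e] at this
      calc _ = 1 + -(r ^ 2 / m) := by ring
        _ ≤ _ := this
        _ = _ := by ring
    calc 1 - r ^ 2 / m ≤ (1 - (r / m) ^ 2) ^ m := h3
      _ ≤ ((1 - r / m) * Real.exp (r / m)) ^ m := pow_le_pow_left₀ (by linarith) h1 m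
      _ = (1 - r / m) ^ m * Real.exp r := by
          rw [mul_pow, ← Real.exp_nat_mul, mul_div_cancel₀ _ hm'.ne']
      _ ≤ E := by
          rw [hE]
          exact mul_le_mul_of_nonneg_right (pow_le_pow_of_le_one hq0 hq1 (Nat.sub_le m k))
            (Real.exp_pos r).le
  have hEu : E ≤ 1 + r * Real.exp r * k / m := by
    have h1 : 1 - r / m ≤ Real.exp (-(r / m)) := Real.one_sub_le_exp_neg _
    have hkm : (k : ℝ) ≤ m := by exact_mod_cast hk
    have h2 : E ≤ Real.exp (r * (k / m)) := by
      calc E ≤ Real.exp (-(r / m)) ^ (m - k) * Real.exp r := by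
            rw [hE]; gcongr
        _ = Real.exp (r * (k / m)) := by
            rw [← Real.exp_nat_mul, ← Real.exp_add, Nat.cast_sub hk]
            congr 1; field_simp; ring
    have h3 : r * ((k : ℝ) / m) ≤ r :=
      mul_le_of_le_one_right hr ((div_le_one hm').2 hkm)
    set y : ℝ := r * (k / m)
    have hy : 0 ≤ y := by positivity
    -- From e^y − 1 ≤ y e^y and y ≤ r.
    have h4 : Real.exp y ≤ 1 + y * Real.exp r := by
      have h5 := Real.one_sub_le_exp_neg y
      have h6 : Real.exp y * Real.exp (-y) = 1 := by rw [← Real.exp_add]; simp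
      have h7 := Real.exp_le_exp.2 h3
      nlinarith [Real.exp_pos y]
    calc E ≤ _ := h2
      _ ≤ _ := h4
      _ = _ := by simp only [y]; ring
  rw [hb]
  have e : poissonWeight r k * (D * E) - poissonWeight r k = poissonWeight r k * (D * E - 1) := by
    ring
  rw [e, abs_mul, abs_of_nonneg hp0, mul_div_assoc]
  refine mul_le_mul_of_nonneg_left ?_ hp0
  have hk2 : 0 ≤ (k : ℝ) ^ 2 / m := by positivity
  have hr2 : 0 ≤ r ^ 2 / m := by positivity
  have hrk : 0 ≤ r * Real.exp r * k / m := by positivity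
  rw [add_div, add_div, abs_le]
  constructor
  -- If r² ≥ m the lower bound is at most −1 and D·E ≥ 0 suffices. Otherwise the two lower bounds
  -- may be multiplied.
  · by_cases hneg : 1 - r ^ 2 / m ≤ 0
    · nlinarith [mul_nonneg hD0 hE0]
    · nlinarith [mul_nonneg hD0 (sub_nonneg.2 hEl), mul_nonneg hk2 hr2]
  · nlinarith [mul_le_mul_of_nonneg_right hD1 hE0]

/-- The Poisson mean of `f`. -/
noncomputable def poissonMean (r : ℝ) (f : ℕ → ℝ) : ℝ := ∑' k, poissonWeight r k * f k

theorem abs_poissonMean_le (hr : 0 ≤ r) {f : ℕ → ℝ} {c : ℝ} (hf : ∀ k, |f k| ≤ c) :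
    |poissonMean r f| ≤ c := by
  have hs := (hasSum_poissonWeight (r := r)).mul_right c
  have := tsum_of_norm_bounded (f := fun k => poissonWeight r k * f k) hs fun k => by
    rw [norm_mul, Real.norm_eq_abs, Real.norm_eq_abs, abs_of_nonneg (poissonWeight_nonneg hr k)]
    exact mul_le_mul_of_nonneg_left (hf k) (poissonWeight_nonneg hr k)
  rwa [one_mul] at this

/-- Sum the pointwise bound against |f k| ≤ k; Poisson moments up to order three give the constant.
Uniformity in f allows f to depend on an independent second vector. -/
theorem exists_multinomialMean_sub_poissonMean_le (hr : 0 ≤ r) :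
    ∃ C : ℝ, 0 ≤ C ∧ ∀ {d : ℕ} (x : Fin d → ℝ) (i : Fin d) (m : ℕ), x ∈ simplex d → 1 ≤ m →
      x i = r / m → ∀ f : ℕ → ℝ, (∀ k, |f k| ≤ k) →
        |multinomialMean x m (fun k => f (k i)) - poissonMean r f| ≤ C / m := by
  have hS : Summable fun k : ℕ => poissonWeight r k *
      ((k : ℝ) ^ 2 + r ^ 2 + r * Real.exp r * k) * k := by
    have h1 := summable_poissonWeight_mul_pow (r := r) 1
    have h2 := summable_poissonWeight_mul_pow (r := r) 2
    have h3 := summable_poissonWeight_mul_pow (r := r) 3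
    refine ((h3.add (h1.mul_left (r ^ 2))).add (h2.mul_left (r * Real.exp r))).congr fun k => ?_
    ring
  refine ⟨∑' k : ℕ, poissonWeight r k * ((k : ℝ) ^ 2 + r ^ 2 + r * Real.exp r * k) * k,
    tsum_nonneg fun k => ?_, ?_⟩
  · have := poissonWeight_nonneg hr k
    positivity
  intro d x i m hx hm hxi f hf
  have hm' : (0 : ℝ) < m := by positivity
  have hrm : r ≤ m := by
    have := (hx.1 i).2
    rwa [hxi, div_le_one hm'] at this
  set b : ℕ → ℝ := fun k => (m.choose k : ℝ) * (r / m) ^ k * (1 - r / m) ^ (m - k) with hb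
  have hfin : HasSum (fun k => b k * f k) (multinomialMean x m fun k => f (k i)) := by
    rw [multinomialMean_comp_coord hx i f, hxi]
    refine hasSum_sum_of_ne_finset_zero fun k hk => ?_
    rw [Finset.mem_range, not_lt] at hk
    simp [hb, Nat.choose_eq_zero_of_lt (Nat.lt_of_succ_le hk)]
  have hpo := (summable_poissonWeight_mul hr hf).hasSum
  rw [poissonMean, ← (hfin.sub hpo).tsum_eq, ← Real.norm_eq_abs]
  refine tsum_of_norm_bounded (hS.hasSum.div_const (m : ℝ)) fun k => ?_
  have h1 := abs_binomial_sub_poissonWeight_le hr hm hrm k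
  rw [← sub_mul, norm_mul, Real.norm_eq_abs, Real.norm_eq_abs]
  calc _ ≤ (poissonWeight r k * ((k : ℝ) ^ 2 + r ^ 2 + r * Real.exp r * k) / m) * k :=
        mul_le_mul h1 (hf k) (abs_nonneg _) ((abs_nonneg _).trans h1)
    _ = _ := by ring

end Poisson

/-! ### Two independent Poisson variables and the Bessel functions -/

section PoissonPair

variable {r : ℝ}

/-- The mean of `f` under the law of two independent Poisson variables with mean `r`. -/
noncomputable def poissonPairMean (r : ℝ) (f : ℕ × ℕ → ℝ) : ℝ :=
  ∑' z : ℕ × ℕ, poissonWeight r z.1 * poissonWeight r z.2 * f z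

theorem summable_poissonPair_of_le (hr : 0 ≤ r) {f : ℕ × ℕ → ℝ} (hf : ∀ z, |f z| ≤ z.1) :
    Summable fun z : ℕ × ℕ => poissonWeight r z.1 * poissonWeight r z.2 * f z := by
  have h := Summable.mul_of_nonneg (summable_poissonWeight_mul_pow (r := r) 1)
    (hasSum_poissonWeight (r := r)).summable
    (fun k => mul_nonneg (poissonWeight_nonneg hr k) (by positivity)) (poissonWeight_nonneg hr)
  refine Summable.of_norm_bounded h fun z => ?_
  have h1 := poissonWeight_nonneg hr z.1
  have h2 := poissonWeight_nonneg hr z.2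
  rw [norm_mul, Real.norm_eq_abs, Real.norm_eq_abs, abs_of_nonneg (by positivity)]
  calc _ ≤ poissonWeight r z.1 * poissonWeight r z.2 * z.1 := by
        have := hf z; gcongr
    _ = _ := by ring

theorem summable_poissonPair (hr : 0 ≤ r) {f : ℕ × ℕ → ℝ} (hf : ∀ z, |f z| ≤ 1) :
    Summable fun z : ℕ × ℕ => poissonWeight r z.1 * poissonWeight r z.2 * f z := by
  have h := Summable.mul_of_nonneg (hasSum_poissonWeight (r := r)).summable
    (hasSum_poissonWeight (r := r)).summable (poissonWeight_nonneg hr) (poissonWeight_nonneg hr)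
  refine Summable.of_norm_bounded h fun z => ?_
  have h1 := poissonWeight_nonneg hr z.1
  have h2 := poissonWeight_nonneg hr z.2
  rw [norm_mul, Real.norm_eq_abs, Real.norm_eq_abs, abs_of_nonneg (by positivity)]
  exact mul_le_of_le_one_right (by positivity) (hf z)

theorem poissonPairMean_eq_iterated {f : ℕ × ℕ → ℝ}
    (hf : Summable fun z : ℕ × ℕ => poissonWeight r z.1 * poissonWeight r z.2 * f z) :
    poissonPairMean r f = poissonMean r fun k => poissonMean r fun l => f (k, l) := by
  rw [poissonPairMean, hf.tsum_prod]
  simp only [poissonMean, mul_assoc, tsum_mul_left]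

theorem poissonPairMean_swap (f : ℕ × ℕ → ℝ) :
    poissonPairMean r (fun z => f z.swap) = poissonPairMean r f := by
  rw [poissonPairMean, poissonPairMean, ← (Equiv.prodComm ℕ ℕ).tsum_eq]
  refine tsum_congr fun z => ?_
  simp [mul_comm (poissonWeight r z.2)]

/-- The Chen–Stein identity: the term at 0 vanishes and the rest shifts by one. -/
theorem poissonMean_mul_self {f : ℕ → ℝ}
    (hf : Summable fun k : ℕ => poissonWeight r k * (k * f k)) :
    poissonMean r (fun k => k * f k) = r * poissonMean r fun k => f (k + 1) := by
  rw [poissonMean, hf.tsum_eq_zero_add, poissonMean, ← tsum_mul_left]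
  simp only [Nat.cast_zero, zero_mul, mul_zero, zero_add]
  refine tsum_congr fun k => ?_
  linear_combination f (k + 1) * succ_mul_poissonWeight (r := r) k

theorem poissonPairMean_mul_fst (hr : 0 ≤ r) {f : ℕ × ℕ → ℝ} (hf : ∀ z, |f z| ≤ 1) :
    poissonPairMean r (fun z => z.1 * f z) = r * poissonPairMean r fun z => f (z.1 + 1, z.2) := by
  have hs : ∀ l, Summable fun k : ℕ => poissonWeight r k * (k * f (k, l)) := fun l =>
    summable_poissonWeight_mul hr fun k => by
      rw [abs_mul, Nat.abs_cast]
      exact mul_le_of_le_one_right (by positivity) (hf _)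
  have h1 : Summable fun z : ℕ × ℕ => poissonWeight r z.1 * poissonWeight r z.2 *
      (z.1 * f z) := summable_poissonPair_of_le hr fun z => by
    rw [abs_mul, Nat.abs_cast]
    exact mul_le_of_le_one_right (by positivity) (hf _)
  have h1' : Summable fun z : ℕ × ℕ => poissonWeight r z.1 * poissonWeight r z.2 *
      (z.2 * f z.swap) := by
    refine ((Equiv.prodComm ℕ ℕ).summable_iff.2 h1).congr fun z => ?_
    simp [mul_comm (poissonWeight r z.2)]
  have h2 : Summable fun z : ℕ × ℕ => poissonWeight r z.1 * poissonWeight r z.2 *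
      f (z.2 + 1, z.1) := summable_poissonPair hr fun z => hf _
  -- The swap makes the first variable the inner one, where the one-variable identity applies.
  rw [← poissonPairMean_swap fun z : ℕ × ℕ => (z.1 : ℝ) * f z,
    ← poissonPairMean_swap fun z => f (z.1 + 1, z.2)]
  simp only [Prod.fst_swap, Prod.snd_swap]
  rw [poissonPairMean_eq_iterated h1', poissonPairMean_eq_iterated h2]
  simp only [Prod.swap_prod_mk, poissonMean_mul_self (hs _)]
  rw [poissonMean, poissonMean, ← tsum_mul_left]
  exact tsum_congr fun k => by ring

theorem poissonPairMean_add (hr : 0 ≤ r) {f g : ℕ × ℕ → ℝ} (hf : ∀ z, |f z| ≤ 1)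
    (hg : ∀ z, |g z| ≤ 1) :
    poissonPairMean r (fun z => f z + g z) = poissonPairMean r f + poissonPairMean r g := by
  rw [poissonPairMean, poissonPairMean, poissonPairMean,
    ← (summable_poissonPair hr hf).tsum_add (summable_poissonPair hr hg)]
  exact tsum_congr fun z => by ring

theorem poissonPairMean_one (hr : 0 ≤ r) : poissonPairMean r (fun _ => 1) = 1 := by
  rw [poissonPairMean_eq_iterated (summable_poissonPair hr fun _ => by simp)]
  simp [poissonMean, hasSum_poissonWeight.tsum_eq]

/-- The products of weights at k and k + ν are, term by term, e^(−2r) times the series of the Bessel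
function at 2r. -/
theorem poissonPairMean_diagonal (hr : 0 ≤ r) (ν : ℕ) :
    poissonPairMean r (fun z => if z.2 = z.1 + ν then 1 else 0)
      = Real.exp (-2 * r) * besselI ν (2 * r) := by
  rw [poissonPairMean_eq_iterated (summable_poissonPair hr fun z => by split_ifs <;> simp)]
  simp only [poissonMean, mul_ite, mul_one, mul_zero, tsum_ite_eq]
  rw [besselI, ← tsum_mul_left]
  refine tsum_congr fun k => ?_
  have e : Real.exp (-2 * r) = Real.exp (-r) * Real.exp (-r) := by
    rw [← Real.exp_add]; ring_nf
  rw [poissonWeight, poissonWeight, e, mul_div_cancel_left₀ r two_ne_zero]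
  field_simp
  ring

/-- The mean of the minimum of two independent Poisson variables. -/
theorem poissonMean_min (hr : 0 ≤ r) :
    (poissonMean r fun k => poissonMean r fun l => ((min k l : ℕ) : ℝ))
      = r * (1 - Real.exp (-2 * r) * (besselI 0 (2 * r) + besselI 1 (2 * r))) := by
  -- By symmetry E min(N, N') = E[N; N ≤ N'] + E[N; N < N'] (`e1`), and Chen–Stein turns this into
  -- r(P(N < N') + P(N + 1 < N')). By `e3` and `e4` the bracket equals 1 − P(N' = N) − P(N' = N +
  -- 1).
  let lt : ℕ × ℕ → ℝ := fun z => if z.1 < z.2 then 1 else 0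
  let le : ℕ × ℕ → ℝ := fun z => if z.1 ≤ z.2 then 1 else 0
  have hlt : ∀ z, |lt z| ≤ 1 := fun z => by simp only [lt]; split_ifs <;> simp
  have hle : ∀ z, |le z| ≤ 1 := fun z => by simp only [le]; split_ifs <;> simp
  have hmul : ∀ f : ℕ × ℕ → ℝ, (∀ z, |f z| ≤ 1) → ∀ z : ℕ × ℕ, |(z.1 : ℝ) * f z| ≤ z.1 := by
    intro f hf z
    rw [abs_mul, Nat.abs_cast]
    exact mul_le_of_le_one_right (by positivity) (hf z)
  have hmin : Summable fun z : ℕ × ℕ => poissonWeight r z.1 * poissonWeight r z.2 *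
      ((min z.1 z.2 : ℕ) : ℝ) := summable_poissonPair_of_le hr fun z => by
    rw [Nat.abs_cast]; exact_mod_cast min_le_left _ _
  have hs2 : Summable fun z : ℕ × ℕ => poissonWeight r z.1 * poissonWeight r z.2 *
      (z.swap.1 * lt z.swap) := by
    refine ((Equiv.prodComm ℕ ℕ).summable_iff.2
      (summable_poissonPair_of_le hr (hmul lt hlt))).congr fun z => ?_
    simp [mul_comm (poissonWeight r z.2)]
  have e1 : poissonPairMean r (fun z => ((min z.1 z.2 : ℕ) : ℝ))
      = poissonPairMean r (fun z => z.1 * le z) + poissonPairMean r (fun z => z.1 * lt z) := by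
    rw [← poissonPairMean_swap fun z : ℕ × ℕ => (z.1 : ℝ) * lt z]
    rw [poissonPairMean, poissonPairMean, poissonPairMean,
      ← (summable_poissonPair_of_le hr (hmul le hle)).tsum_add hs2]
    refine tsum_congr fun z => ?_
    simp only [lt, le, Prod.fst_swap, Prod.snd_swap]
    rcases le_or_gt z.1 z.2 with h | h
    · simp [h, not_lt.2 h]
    · simp [h, not_le.2 h, h.le]
  have e2 : (fun z : ℕ × ℕ => le (z.1 + 1, z.2)) = lt := by
    ext z; simp [lt, le]
  have e3 : poissonPairMean r lt = poissonPairMean r (fun z => lt (z.1 + 1, z.2))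
      + poissonPairMean r fun z => if z.2 = z.1 + 1 then 1 else 0 := by
    rw [← poissonPairMean_add hr (fun z => hlt _) fun z => by split_ifs <;> simp]
    congr 1
    ext z
    simp only [lt]
    rcases lt_trichotomy z.2 (z.1 + 1) with h | h | h
    · simp [not_lt.2 h.le, h.ne, not_lt.2 (Nat.le_of_lt_succ h)]
    · simp [h]
    · simp [h, h.ne', (Nat.lt_succ_self z.1).trans h]
  have e4 : poissonPairMean r lt + poissonPairMean r lt
      + (poissonPairMean r fun z => if z.2 = z.1 + 0 then 1 else 0) = 1 := by
    conv_lhs => enter [1, 2]; rw [← poissonPairMean_swap]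
    rw [← poissonPairMean_add hr hlt (fun z => hlt _), ← poissonPairMean_add hr
      (fun z => ?_) (fun z => by split_ifs <;> simp)]
    · refine Eq.trans ?_ (poissonPairMean_one hr)
      congr 1
      ext z
      simp only [lt, Prod.fst_swap, Prod.snd_swap]
      rcases lt_trichotomy z.1 z.2 with h | h | h
      · simp [h, not_lt.2 h.le, h.ne']
      · simp [h]
      · simp [h, not_lt.2 h.le, h.ne]
    · simp only [lt, Prod.fst_swap, Prod.snd_swap]
      rcases lt_trichotomy z.1 z.2 with h | h | h
      · simp [h, not_lt.2 h.le]
      · simp [h]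
      · simp [h, not_lt.2 h.le]
  rw [poissonPairMean_diagonal hr] at e3 e4
  rw [← poissonPairMean_eq_iterated (f := fun z => ((min z.1 z.2 : ℕ) : ℝ)) hmin, e1,
    poissonPairMean_mul_fst hr hle, poissonPairMean_mul_fst hr hlt, e2]
  linear_combination r * e4 - r * e3

/-- For `x i = r / m`, the mean of the minimum of the `i`-th coordinates of two independent
multinomial vectors is close to that of the minimum of two independent Poisson variables. -/
theorem exists_multinomialMean_min_le (hr : 0 ≤ r) :
    ∃ C : ℝ, 0 ≤ C ∧ ∀ {d : ℕ} (x : Fin d → ℝ) (i : Fin d) (m : ℕ), x ∈ simplex d → 1 ≤ m →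
      x i = r / m →
        |(multinomialMean x m fun k => multinomialMean x m fun l => ((min (k i) (l i) : ℕ) : ℝ))
          - r * (1 - Real.exp (-2 * r) * (besselI 0 (2 * r) + besselI 1 (2 * r)))| ≤ C / m := by
  obtain ⟨C, hC0, hC⟩ := exists_multinomialMean_sub_poissonMean_le hr
  refine ⟨2 * C, by positivity, fun {d} x i m hx hm hxi => ?_⟩
  rw [← poissonMean_min hr]
  -- First the inner vector is replaced by a Poisson variable with k fixed, then the outer one; each
  -- stage costs C/m.
  have h1 : |(multinomialMean x m fun k => multinomialMean x m fun l =>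
      ((min (k i) (l i) : ℕ) : ℝ)) - multinomialMean x m fun k => poissonMean r fun l =>
      ((min (k i) l : ℕ) : ℝ)| ≤ C / m := by
    rw [← multinomialMean_sub]
    refine (abs_multinomialMean_le hx fun k _ => ?_).trans (multinomialMean_const hx (C / m)).le
    refine hC x i m hx hm hxi (fun l => ((min (k i) l : ℕ) : ℝ)) fun l => ?_
    rw [Nat.abs_cast]; exact_mod_cast min_le_right _ _
  have h2 := hC x i m hx hm hxi (fun k => poissonMean r fun l => ((min k l : ℕ) : ℝ)) fun k =>
    abs_poissonMean_le hr fun l => by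
      rw [Nat.abs_cast]; exact_mod_cast min_le_left _ _
  have := (abs_sub_le _ _ _).trans (add_le_add h1 h2)
  refine this.trans (le_of_eq (by ring))

end PoissonPair

/-! ### Mean absolute difference of binomials via a Fourier integral -/

section AbsoluteMoment

open Set Filter Topology

/-- An integrable majorant at both ends: the quadratic bound serves near 0, the constant one near
infinity. -/
theorem abs_div_sq_le {u A B t : ℝ} (hu : 0 ≤ u) (hA : u ≤ A * t ^ 2) (hB : u ≤ B) (ht : 0 < t) :
    ‖u / t ^ 2‖ ≤ (A + B) * (1 + t ^ 2)⁻¹ := by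
  rw [Real.norm_eq_abs, abs_of_nonneg (by positivity), ← div_eq_mul_inv,
    div_le_div_iff₀ (by positivity) (by positivity)]
  nlinarith [mul_le_mul_of_nonneg_right hB (sq_nonneg t)]

theorem one_sub_cos_bounds (s t : ℝ) : 0 ≤ 1 - Real.cos (s * t) ∧
    1 - Real.cos (s * t) ≤ s ^ 2 / 2 * t ^ 2 ∧ 1 - Real.cos (s * t) ≤ 2 := by
  refine ⟨by linarith [Real.cos_le_one (s * t)], ?_, by linarith [Real.neg_one_le_cos (s * t)]⟩
  have := Real.one_sub_sq_div_two_le_cos (x := s * t)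
  nlinarith

theorem integrableOn_one_sub_cos (s : ℝ) :
    IntegrableOn (fun t => (1 - Real.cos (s * t)) / t ^ 2) (Ioi 0) := by
  refine Integrable.mono' ((integrable_inv_one_add_sq.const_mul (s ^ 2 / 2 + 2)).integrableOn)
    (Measurable.aestronglyMeasurable (by fun_prop)) ?_
  filter_upwards [ae_restrict_mem measurableSet_Ioi] with t ht
  obtain ⟨h1, h2, h3⟩ := one_sub_cos_bounds s t
  exact abs_div_sq_le h1 h2 h3 ht

theorem integral_one_sub_cos_mul (s : ℝ) :
    ∫ t in Ioi (0 : ℝ), (1 - Real.cos (s * t)) / t ^ 2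
      = |s| * ∫ t in Ioi (0 : ℝ), (1 - Real.cos t) / t ^ 2 := by
  have hcos : ∀ t, Real.cos (s * t) = Real.cos (|s| * t) := by
    intro t
    rcases abs_choice s with h | h <;> rw [h]
    rw [neg_mul, Real.cos_neg]
  simp only [hcos]
  rcases (abs_nonneg s).eq_or_lt with h | h
  · simp [← h]
  have h1 := integral_comp_mul_left_Ioi (fun t => (1 - Real.cos t) / t ^ 2) 0 h
  rw [mul_zero, smul_eq_mul] at h1
  have h2 : ∀ t, (1 - Real.cos (|s| * t)) / t ^ 2
      = |s| ^ 2 * ((1 - Real.cos (|s| * t)) / (|s| * t) ^ 2) := by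
    intro t
    rw [mul_pow, ← div_div, mul_div_assoc', mul_div_cancel₀ _ (by positivity)]
  simp only [h2]
  rw [integral_const_mul, h1]
  field_simp

theorem integral_exp_neg_mul_one_sub_cos (t : ℝ) :
    ∫ x in Ioi (0 : ℝ), Real.exp (-x) * (1 - Real.cos (x * t)) = t ^ 2 * (1 + t ^ 2)⁻¹ := by
  have hd : ∀ x ∈ Ici (0 : ℝ), HasDerivAt (fun x => -Real.exp (-x) + Real.exp (-x) *
      ((Real.cos (x * t) - t * Real.sin (x * t)) * (1 + t ^ 2)⁻¹))
      (Real.exp (-x) * (1 - Real.cos (x * t))) x := by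
    intro x _
    have h1 : HasDerivAt (fun x : ℝ => Real.exp (-x)) (Real.exp (-x) * -1) x :=
      (hasDerivAt_id x).neg.exp
    have h0 : HasDerivAt (fun x : ℝ => x * t) t x := by
      simpa using (hasDerivAt_id x).mul_const t
    have h2 := h0.cos
    have h3 := h0.sin
    have h4 := h1.neg.add (h1.mul ((h2.sub (h3.const_mul t)).mul_const (1 + t ^ 2)⁻¹))
    refine h4.congr_deriv ?_
    simp only [Pi.sub_apply]
    have : (1 + t ^ 2) ≠ 0 := by positivity
    field_simp
    ring
  have hexp : IntegrableOn (fun x : ℝ => Real.exp (-x)) (Ioi 0) := integrableOn_exp_neg_Ioi 0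
  have hi : IntegrableOn (fun x : ℝ => Real.exp (-x) * (1 - Real.cos (x * t))) (Ioi 0) := by
    refine Integrable.mono' (hexp.mul_const 2) (by fun_prop) (Eventually.of_forall fun x => ?_)
    obtain ⟨h1, _, h3⟩ := one_sub_cos_bounds x t
    rw [norm_mul, Real.norm_eq_abs, Real.norm_eq_abs, Real.abs_exp, abs_of_nonneg h1]
    gcongr
  have ht : Tendsto (fun x => -Real.exp (-x) + Real.exp (-x) *
      ((Real.cos (x * t) - t * Real.sin (x * t)) * (1 + t ^ 2)⁻¹)) atTop (𝓝 0) := by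
    have he : Tendsto (fun x : ℝ => Real.exp (-x)) atTop (𝓝 0) := Real.tendsto_exp_neg_atTop_nhds_zero
    have hb : Tendsto (fun x => Real.exp (-x) *
        ((Real.cos (x * t) - t * Real.sin (x * t)) * (1 + t ^ 2)⁻¹)) atTop (𝓝 0) := by
      refine squeeze_zero_norm (a := fun x => Real.exp (-x) * ((1 + |t|) * (1 + t ^ 2)⁻¹))
        (fun x => ?_) (by simpa using he.mul_const _)
      rw [norm_mul, norm_mul, Real.norm_eq_abs, Real.norm_eq_abs, Real.norm_eq_abs, Real.abs_exp,
        abs_of_nonneg (a := (1 + t ^ 2)⁻¹) (by positivity)]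
      have h1 := Real.abs_cos_le_one (x * t)
      have h2 := Real.abs_sin_le_one (x * t)
      have h3 : |Real.cos (x * t) - t * Real.sin (x * t)| ≤ 1 + |t| := by
        refine (abs_sub _ _).trans ?_
        rw [abs_mul]
        have := mul_le_of_le_one_right (abs_nonneg t) h2
        linarith
      gcongr
    simpa using he.neg.add hb
  rw [integral_Ioi_of_hasDerivAt_of_tendsto' hd hi ht]
  have : (1 + t ^ 2) ≠ 0 := by positivity
  simp
  field_simp
  ring

theorem integral_exp_neg_mul_self : ∫ x in Ioi (0 : ℝ), Real.exp (-x) * x = 1 := by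
  have := Real.Gamma_eq_integral (s := 2) (by norm_num)
  rw [Real.Gamma_two] at this
  rw [this]
  norm_num

/-- Integrate e^(−x)(1 − cos(xt))/t² over the quadrant in both orders. Integrating in t first gives,
by scaling, x e^(−x) times the unknown integral; integrating in x first gives 1/(1 + t²). -/
theorem integral_one_sub_cos : ∫ t in Ioi (0 : ℝ), (1 - Real.cos t) / t ^ 2 = Real.pi / 2 := by
  have hint : Integrable (Function.uncurry fun x t : ℝ =>
      Real.exp (-x) * ((1 - Real.cos (x * t)) / t ^ 2))
      ((volume.restrict (Ioi 0)).prod (volume.restrict (Ioi 0))) := by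
    have h1 : IntegrableOn (fun x : ℝ => Real.exp (-x) * (x ^ 2 / 2 + 2)) (Ioi 0) := by
      have h2 := Real.GammaIntegral_convergent (s := 3) (by norm_num)
      have h3 : IntegrableOn (fun x : ℝ => Real.exp (-x) * x ^ 2) (Ioi 0) := by
        refine h2.congr_fun (fun x _ => ?_) measurableSet_Ioi
        norm_num
      refine ((h3.div_const 2).add ((integrableOn_exp_neg_Ioi 0).mul_const 2)).congr ?_
      exact Eventually.of_forall fun x => by simp only [Pi.add_apply]; ring
    have h4 : IntegrableOn (fun t : ℝ => (1 + t ^ 2)⁻¹) (Ioi 0) :=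
      integrable_inv_one_add_sq.integrableOn
    refine Integrable.mono' (Integrable.mul_prod h1 h4) ?_ ?_
    · refine Measurable.aestronglyMeasurable ?_
      simp only [Function.uncurry_def]
      fun_prop
    · rw [Measure.prod_restrict]
      filter_upwards [ae_restrict_mem (measurableSet_Ioi.prod measurableSet_Ioi)] with z hz
      obtain ⟨h5, h6, h7⟩ := one_sub_cos_bounds z.1 z.2
      have := abs_div_sq_le h5 h6 h7 hz.2
      simp only [Function.uncurry_def]
      rw [norm_mul, Real.norm_eq_abs, Real.abs_exp, mul_assoc]
      gcongr
  have h := integral_integral_swap hint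
  have hl : ∀ x ∈ Ioi (0 : ℝ), (∫ t in Ioi (0 : ℝ), Real.exp (-x) *
      ((1 - Real.cos (x * t)) / t ^ 2)) = Real.exp (-x) * x *
        ∫ t in Ioi (0 : ℝ), (1 - Real.cos t) / t ^ 2 := by
    intro x hx
    rw [integral_const_mul, integral_one_sub_cos_mul, abs_of_pos hx, mul_assoc]
  have hr : ∀ t ∈ Ioi (0 : ℝ), (∫ x in Ioi (0 : ℝ), Real.exp (-x) *
      ((1 - Real.cos (x * t)) / t ^ 2)) = (1 + t ^ 2)⁻¹ := by
    intro t ht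
    have ht' : t ≠ 0 := ne_of_gt ht
    simp only [mul_div_assoc']
    rw [integral_div, integral_exp_neg_mul_one_sub_cos]
    field_simp
  rw [setIntegral_congr_fun measurableSet_Ioi hl, setIntegral_congr_fun measurableSet_Ioi hr,
    integral_mul_const, integral_exp_neg_mul_self, one_mul, integral_Ioi_inv_one_add_sq] at h
  simpa using h

theorem one_sub_exp_bounds {a : ℝ} (ha : 0 ≤ a) (t : ℝ) : 0 ≤ 1 - Real.exp (-a * t ^ 2) ∧
    1 - Real.exp (-a * t ^ 2) ≤ a * t ^ 2 ∧ 1 - Real.exp (-a * t ^ 2) ≤ 1 := by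
  refine ⟨?_, ?_, by linarith [Real.exp_pos (-a * t ^ 2)]⟩
  · have : Real.exp (-a * t ^ 2) ≤ 1 := Real.exp_le_one_iff.2 (by nlinarith [sq_nonneg t])
    linarith
  · have := Real.add_one_le_exp (-a * t ^ 2)
    linarith

/-- Integration by parts against −1/t, with vanishing boundary terms, leaves a Gaussian integral. -/
theorem integral_one_sub_exp_neg_mul_sq {a : ℝ} (ha : 0 < a) :
    ∫ t in Ioi (0 : ℝ), (1 - Real.exp (-a * t ^ 2)) / t ^ 2 = √(Real.pi * a) := by
  have hu : ∀ t ∈ Ioi (0 : ℝ), HasDerivAt (fun t => 1 - Real.exp (-a * t ^ 2))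
      (2 * a * t * Real.exp (-a * t ^ 2)) t := by
    intro t _
    have h1 : HasDerivAt (fun t : ℝ => -a * t ^ 2) (-a * (2 * t)) t := by
      simpa using (hasDerivAt_pow 2 t).const_mul (-a)
    refine (h1.exp.const_sub 1).congr_deriv ?_
    ring
  have hv : ∀ t ∈ Ioi (0 : ℝ), HasDerivAt (fun t : ℝ => -t⁻¹) ((t ^ 2)⁻¹) t := by
    intro t ht
    refine (hasDerivAt_inv (ne_of_gt ht)).neg.congr_deriv ?_
    simp
  have hg : IntegrableOn (fun t : ℝ => Real.exp (-a * t ^ 2)) (Ioi 0) :=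
    (integrable_exp_neg_mul_sq ha).integrableOn
  have hu'v : EqOn ((fun t : ℝ => 2 * a * t * Real.exp (-a * t ^ 2)) * fun t => -t⁻¹)
      (fun t => -(2 * a) * Real.exp (-a * t ^ 2)) (Ioi 0) := by
    intro t ht
    have : t ≠ 0 := ne_of_gt ht
    simp only [Pi.mul_apply]
    field_simp
  have hi1 : IntegrableOn ((fun t : ℝ => 1 - Real.exp (-a * t ^ 2)) * fun t => (t ^ 2)⁻¹)
      (Ioi 0) := by
    refine Integrable.mono' ((integrable_inv_one_add_sq.const_mul (a + 1)).integrableOn)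
      ?_ ?_
    · refine Measurable.aestronglyMeasurable ?_
      exact Measurable.mul (by fun_prop) (by fun_prop)
    filter_upwards [ae_restrict_mem measurableSet_Ioi] with t ht
    obtain ⟨h1, h2, h3⟩ := one_sub_exp_bounds ha.le t
    exact abs_div_sq_le h1 h2 h3 ht
  have hi2 : IntegrableOn ((fun t : ℝ => 2 * a * t * Real.exp (-a * t ^ 2)) * fun t => -t⁻¹)
      (Ioi 0) := (IntegrableOn.congr_fun (hg.const_mul (-(2 * a))) hu'v.symm measurableSet_Ioi)
  have h0 : Tendsto ((fun t : ℝ => 1 - Real.exp (-a * t ^ 2)) * fun t => -t⁻¹) (𝓝[>] 0)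
      (𝓝 0) := by
    refine squeeze_zero_norm' (a := fun t => a * t) ?_ ?_
    · filter_upwards [self_mem_nhdsWithin] with t ht
      obtain ⟨h1, h2, -⟩ := one_sub_exp_bounds ha.le t
      have ht : 0 < t := ht
      simp only [Pi.mul_apply]
      rw [norm_mul, norm_neg, norm_inv, Real.norm_eq_abs, Real.norm_eq_abs, abs_of_nonneg h1,
        abs_of_pos ht, ← div_eq_mul_inv, div_le_iff₀ ht]
      linarith
    · have : Tendsto (fun t : ℝ => a * t) (𝓝 0) (𝓝 (a * 0)) := by
        exact (continuous_const.mul continuous_id).tendsto 0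
      rw [mul_zero] at this
      exact this.mono_left nhdsWithin_le_nhds
  have hinf : Tendsto ((fun t : ℝ => 1 - Real.exp (-a * t ^ 2)) * fun t => -t⁻¹) atTop
      (𝓝 0) := by
    refine squeeze_zero_norm' (a := fun t => t⁻¹) ?_ tendsto_inv_atTop_zero
    filter_upwards [eventually_gt_atTop 0] with t ht
    obtain ⟨h1, -, h3⟩ := one_sub_exp_bounds ha.le t
    simp only [Pi.mul_apply]
    rw [norm_mul, norm_neg, norm_inv, Real.norm_eq_abs, Real.norm_eq_abs, abs_of_nonneg h1,
      abs_of_pos ht]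
    exact mul_le_of_le_one_left (by positivity) h3
  have h := integral_Ioi_mul_deriv_eq_deriv_mul hu hv hi1 hi2 h0 hinf
  simp only [div_eq_mul_inv]
  rw [h]
  have h2 := setIntegral_congr_fun (μ := volume) measurableSet_Ioi hu'v
  simp only [Pi.mul_apply] at h2
  rw [h2, integral_const_mul, integral_gaussian_Ioi, Real.sqrt_div' _ ha.le,
    Real.sqrt_mul Real.pi_pos.le]
  have h3 : √a ≠ 0 := (Real.sqrt_pos.2 ha).ne'
  have h4 : √a ^ 2 = a := Real.sq_sqrt ha.le
  field_simp
  rw [h4]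
  ring

/-- By the half-angle formula the sequence is (t²/2) sinc²(t/(2√m)) for m > 0. -/
theorem tendsto_mul_one_sub_cos (t : ℝ) :
    Tendsto (fun m : ℕ => (m : ℝ) * (1 - Real.cos (t / √m))) atTop (𝓝 (t ^ 2 / 2)) := by
  have h1 : Tendsto (fun m : ℕ => t / √(m : ℝ) / 2) atTop (𝓝 0) := by
    have : Tendsto (fun m : ℕ => √(m : ℝ)) atTop atTop :=
      Real.tendsto_sqrt_atTop.comp tendsto_natCast_atTop_atTop
    simpa using (this.const_div_atTop t).div_const 2
  have h2 : Tendsto (fun m : ℕ => t ^ 2 / 2 * Real.sinc (t / √(m : ℝ) / 2) ^ 2) atTop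
      (𝓝 (t ^ 2 / 2 * Real.sinc 0 ^ 2)) :=
    (((Real.continuous_sinc.tendsto 0).comp h1).pow 2).const_mul _
  rw [Real.sinc_zero, one_pow, mul_one] at h2
  refine h2.congr' ?_
  filter_upwards [eventually_gt_atTop 0] with m hm
  have hm' : (0 : ℝ) < m := by exact_mod_cast hm
  have hs : √(m : ℝ) ^ 2 = m := Real.sq_sqrt hm'.le
  have hs0 : √(m : ℝ) ≠ 0 := (Real.sqrt_pos.2 hm').ne'
  by_cases ht : t = 0
  · simp [ht]
  have h3 : t / √(m : ℝ) / 2 ≠ 0 := by positivity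
  rw [Real.sinc_of_ne_zero h3]
  have h4 : Real.cos (t / √m) = 1 - 2 * Real.sin (t / √(m : ℝ) / 2) ^ 2 := by
    have := Real.cos_two_mul (t / √(m : ℝ) / 2)
    rw [mul_div_cancel₀ _ two_ne_zero, Real.cos_sq'] at this
    linarith
  rw [h4]
  field_simp
  rw [hs]
  ring

variable {d : ℕ} {x : Fin d → ℝ}

/-- The integral representation of |s(k_i − l_i)|, averaged over both vectors; the means are finite
sums, so they commute with the integral. -/
theorem integral_one_sub_charFun_pow (hx : x ∈ simplex d) (i : Fin d) (m : ℕ) (s : ℝ) :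
    ∫ t in Ioi (0 : ℝ), (1 - (1 - 2 * (x i * (1 - x i)) * (1 - Real.cos (s * t))) ^ m) / t ^ 2
      = Real.pi / 2 * (|s| * multinomialMean x m fun k => multinomialMean x m fun l =>
        |(k i : ℝ) - l i|) := by
  have h1 : ∀ t : ℝ, (1 - (1 - 2 * (x i * (1 - x i)) * (1 - Real.cos (s * t))) ^ m) / t ^ 2
      = multinomialMean x m fun k => multinomialMean x m fun l =>
        (1 - Real.cos (s * ((k i : ℝ) - l i) * t)) / t ^ 2 := by
    intro t
    have e : ∀ k l : Fin d → ℕ, s * ((k i : ℝ) - l i) * t = s * t * ((k i : ℝ) - l i) :=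
      fun k l => by ring
    simp only [e, div_eq_mul_inv]
    simp only [multinomialMean_mul_const, multinomialMean_sub, multinomialMean_const hx,
      multinomialMean_cos_sub hx]
  simp only [h1]
  rw [integral_multinomialMean fun k => integrable_multinomialMean fun l =>
    integrableOn_one_sub_cos _]
  simp only [integral_multinomialMean fun l => integrableOn_one_sub_cos _]
  simp only [integral_one_sub_cos_mul, integral_one_sub_cos, abs_mul,
    multinomialMean_mul_const, multinomialMean_const_mul]
  ring

/-- The mean absolute difference of the `i`-th coordinates of two independent multinomial
vectors is asymptotic to that of two independent normal variables. -/
theorem tendsto_multinomialMean_abs_sub (hx : x ∈ simplex d) {i : Fin d} (h0 : 0 < x i)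
    (h1 : x i < 1) :
    Tendsto (fun m : ℕ => (√(m : ℝ))⁻¹ * multinomialMean x m fun k => multinomialMean x m fun l =>
      |(k i : ℝ) - l i|) atTop (𝓝 (2 * √(Real.pi⁻¹ * (x i * (1 - x i))))) := by
  set a : ℝ := x i * (1 - x i) with ha
  have ha0 : 0 < a := mul_pos h0 (by linarith)
  have ha1 : a ≤ 1 / 4 := by nlinarith [sq_nonneg (x i - 1 / 2)]
  -- Since a ≤ 1/4 and 1 − cos ≤ 2, the base lies in [0, 1]; the domination below relies on this.
  have hbase : ∀ (m : ℕ) (t : ℝ), 0 ≤ 1 - 2 * a * (1 - Real.cos ((√(m : ℝ))⁻¹ * t)) ∧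
      1 - 2 * a * (1 - Real.cos ((√(m : ℝ))⁻¹ * t)) ≤ 1 := by
    intro m t
    obtain ⟨h2, -, h3⟩ := one_sub_cos_bounds (√(m : ℝ))⁻¹ t
    constructor <;> nlinarith
  have hlim : Tendsto (fun m : ℕ => ∫ t in Ioi (0 : ℝ),
      (1 - (1 - 2 * a * (1 - Real.cos ((√(m : ℝ))⁻¹ * t))) ^ m) / t ^ 2) atTop
      (𝓝 (∫ t in Ioi (0 : ℝ), (1 - Real.exp (-a * t ^ 2)) / t ^ 2)) := by
    refine tendsto_integral_of_dominated_convergence (fun t => (a + 1) * (1 + t ^ 2)⁻¹)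
      (fun m => ?_) ?_ (fun m => ?_) ?_
    · exact Measurable.aestronglyMeasurable (by fun_prop)
    · exact (integrable_inv_one_add_sq.const_mul (a + 1)).integrableOn
    · filter_upwards [ae_restrict_mem measurableSet_Ioi] with t ht
      obtain ⟨h2, h3⟩ := hbase m t
      refine abs_div_sq_le ?_ ?_ ?_ ht
      · linarith [pow_le_one₀ (n := m) h2 h3]
      -- Bernoulli bounds the numerator by 2am(1 − cos(t/√m)) ≤ a t², uniformly in m.
      · have hb := one_add_mul_le_pow
          (a := -(2 * a * (1 - Real.cos ((√(m : ℝ))⁻¹ * t)))) (by linarith) m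
        rw [← sub_eq_add_neg] at hb
        obtain ⟨-, h4, -⟩ := one_sub_cos_bounds (√(m : ℝ))⁻¹ t
        have h5 : (m : ℝ) * (√(m : ℝ))⁻¹ ^ 2 ≤ 1 := by
          rw [inv_pow, Real.sq_sqrt (Nat.cast_nonneg m)]
          exact mul_inv_le_one
        have h6 : (m : ℝ) * (1 - Real.cos ((√(m : ℝ))⁻¹ * t)) ≤ t ^ 2 / 2 := by
          calc _ ≤ (m : ℝ) * ((√(m : ℝ))⁻¹ ^ 2 / 2 * t ^ 2) := by gcongr
            _ = ((m : ℝ) * (√(m : ℝ))⁻¹ ^ 2) * (t ^ 2 / 2) := by ring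
            _ ≤ 1 * (t ^ 2 / 2) := by gcongr
            _ = _ := one_mul _
        nlinarith
      · linarith [pow_nonneg h2 m]
    · refine Eventually.of_forall fun t => ?_
      have h2 : Tendsto (fun m : ℕ => (m : ℝ) * (-(2 * a) * (1 - Real.cos ((√(m : ℝ))⁻¹ * t))))
          atTop (𝓝 (-a * t ^ 2)) := by
        have := (tendsto_mul_one_sub_cos t).const_mul (-(2 * a))
        have e : -(2 * a) * (t ^ 2 / 2) = -a * t ^ 2 := by ring
        rw [e] at this
        refine this.congr fun m => ?_
        rw [div_eq_inv_mul]; ring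
      have h3 := Real.tendsto_one_add_pow_exp_of_tendsto h2
      refine ((h3.const_sub 1).div_const (t ^ 2)).congr fun m => ?_
      ring_nf
  rw [integral_one_sub_exp_neg_mul_sq ha0] at hlim
  have h2 := hlim.const_mul (2 / Real.pi)
  have e : 2 / Real.pi * √(Real.pi * a) = 2 * √(Real.pi⁻¹ * a) := by
    rw [Real.sqrt_mul Real.pi_pos.le, Real.sqrt_mul (inv_nonneg.2 Real.pi_pos.le), Real.sqrt_inv]
    have h3 : √Real.pi ≠ 0 := (Real.sqrt_pos.2 Real.pi_pos).ne'
    have h4 : Real.pi = √Real.pi ^ 2 := (Real.sq_sqrt Real.pi_pos.le).symm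
    have h5 := Real.pi_ne_zero
    field_simp
    rw [← h4]
  rw [e] at h2
  refine h2.congr fun m => ?_
  rw [ha, integral_one_sub_charFun_pow hx, abs_of_nonneg (by positivity)]
  have h5 := Real.pi_ne_zero
  field_simp

end AbsoluteMoment

/-! ### Expansion of the kernel variance in the three regimes -/

section Asymptotics

open Filter Topology

variable {d : ℕ}

theorem multinomialMean_sq_min_sub_le {x : Fin d → ℝ} {m : ℕ} (hx : x ∈ simplex d) (i : Fin d)
    (c : ℝ) :
    (multinomialMean x m fun k => multinomialMean x m fun l =>
      (((min (k i) (l i) : ℕ) : ℝ) / m - c) ^ 2)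
      ≤ 2 * multinomialMean x m fun k => ((k i : ℝ) / m - c) ^ 2 := by
  calc _ ≤ multinomialMean x m fun k => multinomialMean x m fun l =>
        (((k i : ℝ) / m - c) ^ 2 + ((l i : ℝ) / m - c) ^ 2) := by
        refine multinomialMean_mono hx fun k _ => multinomialMean_mono hx fun l _ => ?_
        rcases min_choice (k i) (l i) with h | h <;> rw [h]
        · exact le_add_of_nonneg_right (sq_nonneg _)
        · exact le_add_of_nonneg_left (sq_nonneg _)
    _ = _ := by
        simp only [multinomialMean_add, multinomialMean_const hx]
        ring

theorem multinomialMean_linear {x : Fin d → ℝ} {m : ℕ} (hx : x ∈ simplex d) (a : ℝ)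
    (b c : Fin d → ℝ) (f : Fin d → (Fin d → ℕ) → ℝ) :
    (multinomialMean x m fun k => a + ∑ i, b i * (f i k / m - c i))
      = a + ∑ i, b i * (multinomialMean x m (f i) / m - c i) := by
  rw [multinomialMean_add, multinomialMean_const hx, multinomialMean_sum]
  simp only [multinomialMean_const_mul, multinomialMean_sub, multinomialMean_const hx,
    div_eq_mul_inv, multinomialMean_mul_const]

/-- Taylor expansions at `z` of the two means in `kernelVariance`. -/
theorem exists_taylor_multinomialMean {F : (Fin d → ℝ) → ℝ}
    (hF : ContDiffOn ℝ 3 F (simplex d)) :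
    ∃ C : ℝ, 0 ≤ C ∧ ∀ z ∈ simplex d, ∀ x ∈ simplex d, ∀ m : ℕ, 1 ≤ m →
      |(multinomialMean x m fun k => F fun i => (k i : ℝ) / m)
          - (F z + ∑ i, partialDeriv F i z * (x i - z i))|
        ≤ C * ∑ i, multinomialMean x m (fun k => ((k i : ℝ) / m - z i) ^ 2) ∧
      |(multinomialMean x m fun k => multinomialMean x m fun l =>
          F fun i => ((min (k i) (l i) : ℕ) : ℝ) / m)
          - (F z + ∑ i, partialDeriv F i z * ((multinomialMean x m fun k => multinomialMean x m
            fun l => ((min (k i) (l i) : ℕ) : ℝ)) / m - z i))|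
        ≤ 2 * C * ∑ i, multinomialMean x m (fun k => ((k i : ℝ) / m - z i) ^ 2) := by
  obtain ⟨C, hC0, hC⟩ := exists_taylor_simplex hF
  refine ⟨C, hC0, fun z hz x hx m hm => ⟨?_, ?_⟩⟩
  · have hm' : (m : ℝ) ≠ 0 := by positivity
    have h1 := multinomialMean_linear (m := m) hx (F z) (fun i => partialDeriv F i z) z
      fun i k => (k i : ℝ)
    simp only [multinomialMean_coord hx, mul_div_cancel_left₀ _ hm'] at h1
    rw [← h1, ← multinomialMean_sub, ← multinomialMean_sum, ← multinomialMean_const_mul]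
    refine abs_multinomialMean_le hx fun k hk => ?_
    have := hC z hz _ (div_mem_simplex hm (mem_grid.1 hk))
    rwa [← sub_sub]
  · have h1 := fun k : Fin d → ℕ => multinomialMean_linear (m := m) hx (F z)
      (fun i => partialDeriv F i z) z fun i l => ((min (k i) (l i) : ℕ) : ℝ)
    have h2 := multinomialMean_linear (m := m) hx (F z) (fun i => partialDeriv F i z) z
      fun i k => multinomialMean x m fun l => ((min (k i) (l i) : ℕ) : ℝ)
    simp only [← h1] at h2
    rw [← h2, ← multinomialMean_sub]
    simp only [← multinomialMean_sub]
    have h3 : ∀ k ∈ grid d m, |multinomialMean x m fun l =>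
        F (fun i => ((min (k i) (l i) : ℕ) : ℝ) / m) -
          (F z + ∑ i, partialDeriv F i z * (((min (k i) (l i) : ℕ) : ℝ) / m - z i))|
        ≤ multinomialMean x m fun l =>
          C * ∑ i, (((min (k i) (l i) : ℕ) : ℝ) / m - z i) ^ 2 := by
      intro k hk
      refine abs_multinomialMean_le hx fun l _ => ?_
      have hkl : ∑ i, min (k i) (l i) ≤ m :=
        (Finset.sum_le_sum fun i _ => min_le_left _ _).trans (mem_grid.1 hk)
      have := hC z hz _ (div_mem_simplex hm hkl)
      rwa [← sub_sub]
    refine (abs_multinomialMean_le hx h3).trans ?_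
    simp only [multinomialMean_const_mul, multinomialMean_sum]
    rw [mul_comm 2 C, mul_assoc, Finset.mul_sum _ _ (2 : ℝ)]
    exact mul_le_mul_of_nonneg_left
      (Finset.sum_le_sum fun i _ => multinomialMean_sq_min_sub_le hx i (z i)) hC0

/-- From min(a, b) = (a + b − |a − b|)/2. -/
theorem multinomialMean_min_eq {x : Fin d → ℝ} {m : ℕ} (hx : x ∈ simplex d) (i : Fin d) :
    (multinomialMean x m fun k => multinomialMean x m fun l => ((min (k i) (l i) : ℕ) : ℝ))
      = m * x i - 2⁻¹ * multinomialMean x m fun k => multinomialMean x m fun l =>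
        |(k i : ℝ) - l i| := by
  have h : ∀ k l : Fin d → ℕ, ((min (k i) (l i) : ℕ) : ℝ)
      = 2⁻¹ * ((k i : ℝ) + l i) - 2⁻¹ * |(k i : ℝ) - l i| := by
    intro k l
    rcases le_total (k i) (l i) with hkl | hkl
    · rw [min_eq_left hkl, abs_of_nonpos (sub_nonpos.2 (by exact_mod_cast hkl))]; ring
    · rw [min_eq_right hkl, abs_of_nonneg (sub_nonneg.2 (by exact_mod_cast hkl))]; ring
  simp only [h, multinomialMean_sub, multinomialMean_const_mul, multinomialMean_add,
    multinomialMean_const hx, multinomialMean_coord hx]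
  ring

/-- The leading part scales like the variance itself, so the error analysis reduces to n = 1. -/
theorem leadingVariance_eq (F : (Fin d → ℝ) → ℝ) (J : Finset (Fin d)) (lam x : Fin d → ℝ)
    (n m : ℕ) :
    leadingVariance F J lam x n m = (n : ℝ)⁻¹ * leadingVariance F J lam x 1 m := by
  unfold leadingVariance
  split_ifs <;> push_cast <;> ring

theorem kernelVariance_sub_leadingVariance_empty {F : (Fin d → ℝ) → ℝ}
    (hF : ContDiffOn ℝ 3 F (simplex d)) (lam : Fin d → ℝ) {x : Fin d → ℝ}
    (hx : x ∈ simplex d) (hx01 : ∀ i, x i ∈ Set.Ioo (0 : ℝ) 1) {ε : ℝ} (hε : 0 < ε) :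
    ∃ M : ℕ, ∀ m : ℕ, M ≤ m →
      |kernelVariance F m x - leadingVariance F ∅ lam x 1 m| ≤ ε * (√(m : ℝ))⁻¹ := by
  obtain ⟨C, hC0, hC⟩ := exists_taylor_multinomialMean hF
  set σ : Fin d → ℝ := fun i => √(Real.pi⁻¹ * (x i * (1 - x i))) with hσ
  set T : Fin d → ℕ → ℝ := fun i m => (√(m : ℝ))⁻¹ * multinomialMean x m fun k =>
    multinomialMean x m fun l => |(k i : ℝ) - l i| with hT
  have hTlim : ∀ i, Tendsto (T i) atTop (𝓝 (2 * σ i)) := fun i =>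
    tendsto_multinomialMean_abs_sub hx (hx01 i).1 (hx01 i).2
  -- K/m collects the Taylor remainder of the mean at the minimum and the error of the squared mean;
  -- g bounds √m times the total error.
  set K : ℝ := 2 * C * d + C * d * (2 * |F x| + C * d) with hK
  set g : ℕ → ℝ := fun m => |∑ i, partialDeriv F i x * (σ i - 2⁻¹ * T i m)| + K * (√(m : ℝ))⁻¹
    with hg
  have hglim : Tendsto g atTop (𝓝 0) := by
    have h1 : Tendsto (fun m => ∑ i, partialDeriv F i x * (σ i - 2⁻¹ * T i m)) atTop
        (𝓝 (∑ i, partialDeriv F i x * (σ i - 2⁻¹ * (2 * σ i)))) :=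
      tendsto_finsetSum _ fun i _ => (((hTlim i).const_mul _).const_sub _).const_mul _
    have h2 : Tendsto (fun m : ℕ => (√(m : ℝ))⁻¹) atTop (𝓝 0) :=
      tendsto_inv_atTop_zero.comp (Real.tendsto_sqrt_atTop.comp tendsto_natCast_atTop_atTop)
    simpa using h1.abs.add (h2.const_mul K)
  obtain ⟨M, hM⟩ := eventually_atTop.1 (hglim.eventually_le_const hε)
  refine ⟨max M 1, fun m hm => ?_⟩
  have hm1 : 1 ≤ m := (le_max_right _ _).trans hm
  have hm' : (0 : ℝ) < m := by positivity
  have hs0 : 0 < √(m : ℝ) := Real.sqrt_pos.2 hm'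
  have hs : (√(m : ℝ))⁻¹ * (√(m : ℝ))⁻¹ = (m : ℝ)⁻¹ := by
    rw [← mul_inv, Real.mul_self_sqrt hm'.le]
  obtain ⟨hA, hB⟩ := hC x hx x hx m hm1
  have hvar : ∑ i, multinomialMean x m (fun k => ((k i : ℝ) / m - x i) ^ 2) ≤ d * (m : ℝ)⁻¹ := by
    calc _ ≤ ∑ _i : Fin d, (m : ℝ)⁻¹ := by
          refine Finset.sum_le_sum fun i _ => ?_
          rw [multinomialMean_sq_sub hx hm1, div_eq_mul_inv]
          obtain ⟨h1, h2⟩ := hx01 i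
          exact mul_le_of_le_one_left (by positivity) (by nlinarith)
      _ = _ := by simp
  have hA' := hA.trans (mul_le_mul_of_nonneg_left hvar hC0)
  have hB' := hB.trans (mul_le_mul_of_nonneg_left hvar (by positivity))
  have hmin : ∑ i, partialDeriv F i x * ((multinomialMean x m fun k => multinomialMean x m
      fun l => ((min (k i) (l i) : ℕ) : ℝ)) / m - x i)
      = -((√(m : ℝ))⁻¹ * ∑ i, partialDeriv F i x * (2⁻¹ * T i m)) := by
    rw [Finset.mul_sum, ← Finset.sum_neg_distrib]
    refine Finset.sum_congr rfl fun i _ => ?_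
    rw [multinomialMean_min_eq hx, sub_div, mul_div_cancel_left₀ _ hm'.ne', div_eq_mul_inv, ← hs]
    simp only [hT]
    ring
  rw [hmin] at hB'
  simp only [sub_self, mul_zero, Finset.sum_const_zero, add_zero] at hA'
  have hL : leadingVariance F ∅ lam x 1 m
      = F x * (1 - F x) - (√(m : ℝ))⁻¹ * ∑ i, partialDeriv F i x * σ i := by
    have h1 : zeroOn ∅ x = x := by ext i; simp [zeroOn]
    have h2 : nearBoundary ∅ lam x m = x := by ext i; simp [nearBoundary]
    have h3 : (m : ℝ)⁻¹ * √(m : ℝ) = (√(m : ℝ))⁻¹ := by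
      rw [← hs]; field_simp
    simp only [leadingVariance, h1, h2, Finset.notMem_empty, if_false, if_true, Nat.cast_one,
      inv_one, one_mul, mul_neg, Finset.sum_neg_distrib, hσ]
    rw [← h3, mul_assoc, Finset.mul_sum _ _ √(m : ℝ), add_comm, ← sub_eq_add_neg]
    congr 2
    exact Finset.sum_congr rfl fun i _ => by ring
  rw [kernelVariance, hL]
  set A : ℝ := multinomialMean x m fun k => F fun i => (k i : ℝ) / m
  set B : ℝ := multinomialMean x m fun k => multinomialMean x m fun l =>
    F fun i => ((min (k i) (l i) : ℕ) : ℝ) / m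
  have hminv : (m : ℝ)⁻¹ ≤ 1 := inv_le_one_of_one_le₀ (by exact_mod_cast hm1)
  have hA1 : |A - F x| ≤ C * d := hA'.trans (by
    rw [← mul_assoc]; exact mul_le_of_le_one_right (by positivity) hminv)
  have hA2 : |A ^ 2 - F x ^ 2| ≤ C * d * (2 * |F x| + C * d) * (m : ℝ)⁻¹ := by
    have e : A ^ 2 - F x ^ 2 = (A - F x) * (2 * F x + (A - F x)) := by ring
    rw [e, abs_mul]
    have h1 : |2 * F x + (A - F x)| ≤ 2 * |F x| + C * d := by
      refine (abs_add_le _ _).trans ?_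
      rw [abs_mul, abs_two]
      linarith
    calc _ ≤ (C * (d * (m : ℝ)⁻¹)) * (2 * |F x| + C * d) :=
          mul_le_mul hA' h1 (abs_nonneg _) (by positivity)
      _ = _ := by ring
  have key : B - A ^ 2 - (F x * (1 - F x) - (√(m : ℝ))⁻¹ * ∑ i, partialDeriv F i x * σ i)
      = (√(m : ℝ))⁻¹ * ∑ i, partialDeriv F i x * (σ i - 2⁻¹ * T i m)
        + (B - (F x + -((√(m : ℝ))⁻¹ * ∑ i, partialDeriv F i x * (2⁻¹ * T i m))))
        - (A ^ 2 - F x ^ 2) := by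
    simp only [mul_sub, Finset.sum_sub_distrib]
    ring
  rw [key]
  refine (abs_sub _ _).trans ((add_le_add (abs_add_le _ _) hA2).trans ?_)
  rw [abs_mul, abs_of_pos (inv_pos.2 hs0)]
  have hgm := hM m ((le_max_left _ _).trans hm)
  calc _ ≤ (√(m : ℝ))⁻¹ * |∑ i, partialDeriv F i x * (σ i - 2⁻¹ * T i m)|
        + 2 * C * (d * (m : ℝ)⁻¹) + C * d * (2 * |F x| + C * d) * (m : ℝ)⁻¹ := by gcongr
    _ = g m * (√(m : ℝ))⁻¹ := by
        rw [← hs]; simp only [hg, hK]; ring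
    _ ≤ ε * (√(m : ℝ))⁻¹ := by gcongr

/-- Expansion at the origin, where `hd` provides a zero coordinate and so F(0) = 0. The 1/m in front
of E min(K_i, L_i) improves its O(1/m) Poisson error to O(m⁻²). -/
theorem kernelVariance_sub_leadingVariance_univ (hd : 1 ≤ d) {F : (Fin d → ℝ) → ℝ}
    (hF : ContDiffOn ℝ 3 F (simplex d))
    (hface : ∀ x ∈ simplex d, (∃ i, x i = 0) → F x = 0) {lam : Fin d → ℝ}
    (hlam : ∀ i, 0 < lam i) :
    ∃ C : ℝ, ∀ (x : Fin d → ℝ) (m : ℕ), 1 ≤ m → nearBoundary Finset.univ lam x m ∈ simplex d →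
      |kernelVariance F m (nearBoundary Finset.univ lam x m)
        - leadingVariance F Finset.univ lam x 1 m| ≤ C * ((m : ℝ) ^ 2)⁻¹ := by
  obtain ⟨C, hC0, hC⟩ := exists_taylor_multinomialMean hF
  choose Q hQ0 hQ using fun i => exists_multinomialMean_min_le (hlam i).le
  have h0 : (0 : Fin d → ℝ) ∈ simplex d := ⟨fun i => by simp, by simp⟩
  have hF0 : F 0 = 0 := hface 0 h0 ⟨⟨0, hd⟩, rfl⟩
  set S : ℝ := ∑ i, (lam i + lam i ^ 2) with hS
  have hS0 : 0 ≤ S := Finset.sum_nonneg fun i _ => by have := hlam i; positivity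
  set G : ℝ := ∑ i, |partialDeriv F i 0| * lam i + C * S with hG
  -- The three contributions: Taylor remainder at the minimum, Poisson approximation, and squared
  -- mean, with |E F(K/m)| ≤ G/m.
  refine ⟨2 * C * S + ∑ i, |partialDeriv F i 0| * Q i + G ^ 2, fun x m hm hy => ?_⟩
  have hm' : (0 : ℝ) < m := by positivity
  have hy' : nearBoundary Finset.univ lam x m = fun i => lam i / m := by
    ext i; simp [nearBoundary]
  rw [hy'] at hy ⊢
  set y : Fin d → ℝ := fun i => lam i / m with hyd
  obtain ⟨hA, hB⟩ := hC 0 h0 y hy m hm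
  simp only [Pi.zero_apply, sub_zero, hF0, zero_add] at hA hB
  have hvar : ∑ i, multinomialMean y m (fun k => ((k i : ℝ) / m) ^ 2) ≤ S * ((m : ℝ) ^ 2)⁻¹ := by
    rw [hS, Finset.sum_mul]
    refine Finset.sum_le_sum fun i _ => ?_
    simp only [div_eq_mul_inv, mul_pow, inv_pow]
    rw [multinomialMean_mul_const, multinomialMean_coord_sq hy]
    have e : (m : ℝ) * y i = lam i := mul_div_cancel₀ _ hm'.ne'
    rw [e]
    refine mul_le_mul_of_nonneg_right ?_ (by positivity)
    have h1 := (hy.1 i).1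
    have h2 := (hlam i).le
    nlinarith
  have hA1 := hA.trans (mul_le_mul_of_nonneg_left hvar hC0)
  have hB1 := hB.trans (mul_le_mul_of_nonneg_left hvar (by positivity))
  have hL : leadingVariance F Finset.univ lam x 1 m = ∑ i, partialDeriv F i 0 * ((lam i *
      (1 - Real.exp (-2 * lam i) * (besselI 0 (2 * lam i) + besselI 1 (2 * lam i)))) / m) := by
    have h1 : zeroOn Finset.univ x = 0 := by ext i; simp [zeroOn]
    have h2 : (Finset.univ : Finset (Fin d)) ≠ ∅ :=
      Finset.ne_empty_of_mem (Finset.mem_univ (⟨0, hd⟩ : Fin d))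
    simp only [leadingVariance, h1, Finset.mem_univ, if_true, if_neg h2, Nat.cast_one, inv_one,
      one_mul, add_zero]
    rw [Finset.mul_sum]
    exact Finset.sum_congr rfl fun i _ => by ring
  set A : ℝ := multinomialMean y m fun k => F fun i => (k i : ℝ) / m with hAd
  set B : ℝ := multinomialMean y m fun k => multinomialMean y m fun l =>
    F fun i => ((min (k i) (l i) : ℕ) : ℝ) / m with hBd
  have hA2 : |A| ≤ G * (m : ℝ)⁻¹ := by
    have h1 : |∑ i, partialDeriv F i 0 * y i| ≤ (∑ i, |partialDeriv F i 0| * lam i) * (m : ℝ)⁻¹ := by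
      refine (Finset.abs_sum_le_sum_abs _ _).trans (le_of_eq ?_)
      rw [Finset.sum_mul]
      refine Finset.sum_congr rfl fun i _ => ?_
      rw [abs_mul, abs_of_nonneg (hy.1 i).1, hyd]
      ring
    have h2 : ((m : ℝ) ^ 2)⁻¹ ≤ (m : ℝ)⁻¹ :=
      inv_anti₀ hm' (le_self_pow₀ (by exact_mod_cast hm) two_ne_zero)
    calc |A| = |(A - ∑ i, partialDeriv F i 0 * y i) + ∑ i, partialDeriv F i 0 * y i| := by
          rw [sub_add_cancel]
      _ ≤ C * (S * ((m : ℝ) ^ 2)⁻¹) + (∑ i, |partialDeriv F i 0| * lam i) * (m : ℝ)⁻¹ :=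
          (abs_add_le _ _).trans (add_le_add hA1 h1)
      _ ≤ C * (S * (m : ℝ)⁻¹) + (∑ i, |partialDeriv F i 0| * lam i) * (m : ℝ)⁻¹ := by gcongr
      _ = _ := by rw [hG]; ring
  have hA3 : |A ^ 2| ≤ G ^ 2 * ((m : ℝ) ^ 2)⁻¹ := by
    rw [abs_pow, ← inv_pow, ← mul_pow]
    exact pow_le_pow_left₀ (abs_nonneg _) hA2 2
  have hP : |∑ i, partialDeriv F i 0 * ((multinomialMean y m fun k => multinomialMean y m
      fun l => ((min (k i) (l i) : ℕ) : ℝ)) / m) - leadingVariance F Finset.univ lam x 1 m|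
      ≤ (∑ i, |partialDeriv F i 0| * Q i) * ((m : ℝ) ^ 2)⁻¹ := by
    rw [hL, ← Finset.sum_sub_distrib, Finset.sum_mul]
    refine (Finset.abs_sum_le_sum_abs _ _).trans (Finset.sum_le_sum fun i _ => ?_)
    rw [← mul_sub, ← sub_div, abs_mul, abs_div, abs_of_pos hm']
    calc _ ≤ |partialDeriv F i 0| * (Q i / m / m) := by
          have := hQ i y i m hy hm rfl
          gcongr
      _ = _ := by rw [div_div, ← sq]; ring
  rw [kernelVariance, ← hAd, ← hBd]
  have key : B - A ^ 2 - leadingVariance F Finset.univ lam x 1 m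
      = (B - ∑ i, partialDeriv F i 0 * ((multinomialMean y m fun k => multinomialMean y m
        fun l => ((min (k i) (l i) : ℕ) : ℝ)) / m))
        + (∑ i, partialDeriv F i 0 * ((multinomialMean y m fun k => multinomialMean y m
        fun l => ((min (k i) (l i) : ℕ) : ℝ)) / m) - leadingVariance F Finset.univ lam x 1 m)
        - A ^ 2 := by ring
  rw [key]
  refine (abs_sub _ _).trans ((add_le_add ((abs_add_le _ _).trans (add_le_add hB1 hP)) hA3).trans
    (le_of_eq ?_))
  ring

/-- Setting k_i to 0 lands on a face where F = 0, so the Lipschitz bound gives F(k/m) ≤ C k_i/m;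
then take means. -/
theorem exists_multinomialMean_le_coord {F : (Fin d → ℝ) → ℝ}
    (hF : ContDiffOn ℝ 3 F (simplex d))
    (hface : ∀ x ∈ simplex d, (∃ i, x i = 0) → F x = 0) :
    ∃ C : ℝ, 0 ≤ C ∧ ∀ x ∈ simplex d, ∀ m : ℕ, 1 ≤ m → ∀ i,
      (multinomialMean x m fun k => F fun j => (k j : ℝ) / m) ≤ C * x i := by
  obtain ⟨C, hC0, hC⟩ := exists_lipschitz_simplex hF
  refine ⟨C, hC0, fun x hx m hm i => ?_⟩
  have hm' : (0 : ℝ) < m := by positivity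
  calc _ ≤ multinomialMean x m fun k => C / m * (k i : ℝ) := by
        refine multinomialMean_mono hx fun k hk => ?_
        have hk' : ∑ j, (Function.update k i 0) j ≤ m :=
          (Finset.sum_le_sum fun j _ => by
            by_cases h : j = i
            · subst h; simp
            · simp [h]).trans (mem_grid.1 hk)
        have h1 := div_mem_simplex hm hk'
        have h2 := hC _ h1 _ (div_mem_simplex hm (mem_grid.1 hk))
        rw [hface _ h1 ⟨i, by simp⟩, sub_zero] at h2
        refine (le_abs_self _).trans (h2.trans ?_)
        rw [div_mul_eq_mul_div, mul_div_assoc]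
        refine mul_le_mul_of_nonneg_left ?_ hC0
        refine (pi_norm_le_iff_of_nonneg (by positivity)).2 fun j => ?_
        by_cases h : j = i
        · subst h; simp
        · simp only [Pi.sub_apply, Function.update_of_ne h, sub_self, norm_zero]
          positivity
    _ = C * x i := by
        rw [multinomialMean_const_mul, multinomialMean_coord hx]
        field_simp

/-- Both quantities are O(1/m), which is o(m^(−1/2)), so they are bounded separately and not
compared. -/
theorem kernelVariance_sub_leadingVariance_proper (μ : Measure (Fin d → ℝ))
    [IsProbabilityMeasure μ] (hF : ContDiffOn ℝ 3 (jointCDF μ) (simplex d))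
    (hface : ∀ x ∈ simplex d, (∃ i, x i = 0) → jointCDF μ x = 0)
    {J : Finset (Fin d)} (hJ : J.Nonempty) {lam : Fin d → ℝ} (hlam : ∀ i ∈ J, 0 < lam i)
    {x : Fin d → ℝ} (hx : ∀ i ∉ J, x i ∈ Set.Ioo (0 : ℝ) 1) {ε : ℝ} (hε : 0 < ε) :
    ∃ M : ℕ, ∀ m : ℕ, M ≤ m → nearBoundary J lam x m ∈ simplex d →
      |kernelVariance (jointCDF μ) m (nearBoundary J lam x m)
        - leadingVariance (jointCDF μ) J lam x 1 m| ≤ ε * (√(m : ℝ))⁻¹ := by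
  obtain ⟨C, hC0, hC⟩ := exists_multinomialMean_le_coord hF hface
  obtain ⟨j, hj⟩ := hJ
  set D : ℝ := ∑ i ∈ J, partialDeriv (jointCDF μ) i (zeroOn J x) * (lam i *
    (1 - Real.exp (-2 * lam i) * (besselI 0 (2 * lam i) + besselI 1 (2 * lam i)))) with hD
  have hlim : Tendsto (fun m : ℕ => (C * lam j + |D|) * (√(m : ℝ))⁻¹) atTop (𝓝 0) := by
    have h2 : Tendsto (fun m : ℕ => (√(m : ℝ))⁻¹) atTop (𝓝 0) :=
      tendsto_inv_atTop_zero.comp (Real.tendsto_sqrt_atTop.comp tendsto_natCast_atTop_atTop)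
    simpa using h2.const_mul (C * lam j + |D|)
  obtain ⟨M, hM⟩ := eventually_atTop.1 (hlim.eventually_le_const hε)
  refine ⟨max M 1, fun m hm hy => ?_⟩
  have hm1 : 1 ≤ m := (le_max_right _ _).trans hm
  have hm' : (0 : ℝ) < m := by positivity
  have hs : (√(m : ℝ))⁻¹ * (√(m : ℝ))⁻¹ = (m : ℝ)⁻¹ := by
    rw [← mul_inv, Real.mul_self_sqrt hm'.le]
  have hV0 := kernelVariance_nonneg (m := m) (x := nearBoundary J lam x m) μ
  have hV : kernelVariance (jointCDF μ) m (nearBoundary J lam x m) ≤ C * lam j * (m : ℝ)⁻¹ := by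
    refine (kernelVariance_le μ hy).trans ((hC _ hy m hm1 j).trans (le_of_eq ?_))
    simp only [nearBoundary, if_pos hj]
    ring
  have hle : ∀ i, 0 ≤ zeroOn J x i ∧ zeroOn J x i ≤ nearBoundary J lam x m i := by
    intro i
    by_cases h : i ∈ J
    · simpa [zeroOn, nearBoundary, h] using div_nonneg (hlam i h).le hm'.le
    · simpa [zeroOn, nearBoundary, h] using (hx i h).1.le
  -- Strict because coordinate j drops from λ_j/m > 0 to 0; this is the room needed by
  -- `partialDeriv_eq_zero_of_face`.
  have hsum : ∑ i, |zeroOn J x i| < 1 := by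
    refine lt_of_lt_of_le ?_ hy.2
    refine Finset.sum_lt_sum (fun i _ => abs_le_abs_of_nonneg (hle i).1 (hle i).2)
      ⟨j, Finset.mem_univ j, ?_⟩
    have := hlam j hj
    simp only [zeroOn, nearBoundary, if_pos hj, abs_zero]
    positivity
  have hz : zeroOn J x ∈ simplex d :=
    ⟨fun i => ⟨(hle i).1, (hle i).2.trans (hy.1 i).2⟩, hsum.le⟩
  have hL : leadingVariance (jointCDF μ) J lam x 1 m = (m : ℝ)⁻¹ * D := by
    have h1 : J ≠ ∅ := Finset.ne_empty_of_mem hj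
    simp only [leadingVariance, if_neg h1, Nat.cast_one, inv_one, one_mul, add_zero]
    rw [hD, ← Finset.sum_subset (Finset.subset_univ J)]
    · congr 1
      exact Finset.sum_congr rfl fun i hi => by rw [if_pos hi]
    · intro i _ hi
      have hji : j ≠ i := fun h => hi (h ▸ hj)
      rw [partialDeriv_eq_zero_of_face hF hface hz hji (by simp [zeroOn, hj]) hsum, zero_mul]
  rw [hL]
  refine (abs_sub _ _).trans ?_
  rw [abs_mul, abs_of_nonneg hV0, abs_of_pos (inv_pos.2 hm')]
  have h3 := hM m ((le_max_left _ _).trans hm)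
  calc _ ≤ C * lam j * (m : ℝ)⁻¹ + (m : ℝ)⁻¹ * |D| := by gcongr
    _ = (C * lam j + |D|) * (√(m : ℝ))⁻¹ * (√(m : ℝ))⁻¹ := by rw [← hs]; ring
    _ ≤ ε * (√(m : ℝ))⁻¹ := by gcongr

/-- The asymptotic expansion of `kernelVariance` at points close to the face `x_J = 0`. -/
theorem exists_kernelVariance_sub_leadingVariance_le (hd : 1 ≤ d) (μ : Measure (Fin d → ℝ))
    [IsProbabilityMeasure μ] (hF : ContDiffOn ℝ 3 (jointCDF μ) (simplex d))
    (hface : ∀ x ∈ simplex d, (∃ i, x i = 0) → jointCDF μ x = 0)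
    (J : Finset (Fin d)) (lam : Fin d → ℝ) (hlam : ∀ i ∈ J, 0 < lam i) :
    ∃ C : ℝ, ∀ x : Fin d → ℝ, (∀ i ∉ J, x i ∈ Set.Ioo (0 : ℝ) 1) →
      ∀ ε : ℝ, 0 < ε → ∃ M : ℕ, ∀ m : ℕ, M ≤ m → nearBoundary J lam x m ∈ simplex d →
        |kernelVariance (jointCDF μ) m (nearBoundary J lam x m)
          - leadingVariance (jointCDF μ) J lam x 1 m|
          ≤ C * ((m : ℝ) ^ 2)⁻¹ + (if J ≠ Finset.univ then ε * (√(m : ℝ))⁻¹ else 0) := by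
  by_cases hJ : J = Finset.univ
  · subst hJ
    obtain ⟨C, hC⟩ := kernelVariance_sub_leadingVariance_univ hd hF hface
      (fun i => hlam i (Finset.mem_univ i))
    exact ⟨C, fun x _ ε _ => ⟨1, fun m hm hy => by simpa using hC x m hm hy⟩⟩
  -- For J ≠ [d] the whole error fits in the o term, so the O constant can be 0.
  refine ⟨0, fun x hx ε hε => ?_⟩
  simp only [zero_mul, zero_add, if_pos hJ]
  rcases J.eq_empty_or_nonempty with rfl | hne
  · have hnb : ∀ m, nearBoundary ∅ lam x m = x := fun m => by ext i; simp [nearBoundary]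
    simp only [hnb]
    by_cases hxS : x ∈ simplex d
    · obtain ⟨M, hM⟩ := kernelVariance_sub_leadingVariance_empty hF lam hxS
        (fun i => hx i (Finset.notMem_empty i)) hε
      exact ⟨M, fun m hm _ => hM m hm⟩
    · exact ⟨0, fun m _ h => absurd h hxS⟩
  · exact kernelVariance_sub_leadingVariance_proper μ hF hface hne hlam hx hε

end Asymptotics

end BernsteinSimplex

/-- The quantifier order encodes the uniformity: C is chosen before x, and the threshold M after x
and ε but before n. -/
theorem theorem4 {d : ℕ} (hd : 1 ≤ d)
    (μ : Measure (Fin d → ℝ)) [IsProbabilityMeasure μ]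
    (hC3 : ContDiffOn ℝ 3 (jointCDF μ) (simplex d))
    (hface : ∀ x ∈ simplex d, (∃ i, x i = 0) → jointCDF μ x = 0) :
    (∀ (J : Finset (Fin d)) (lam : Fin d → ℝ), (∀ i ∈ J, 0 < lam i) →
      ∃ C : ℝ, ∀ x : Fin d → ℝ, (∀ i ∉ J, x i ∈ Set.Ioo (0 : ℝ) 1) →
        ∀ ε : ℝ, 0 < ε → ∃ M : ℕ, ∀ n m : ℕ, 1 ≤ n → M ≤ m →
          nearBoundary J lam x m ∈ simplex d →
          ∀ {Ω : Type*} [MeasurableSpace Ω] (P : Measure Ω) [IsProbabilityMeasure P]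
            (X : Fin n → Ω → Fin d → ℝ),
            (∀ j, HasLaw (X j) μ P) → iIndepFun X P →
            |variance (fun ω => bernsteinEstimator (fun j => X j ω) m (nearBoundary J lam x m)) P
                - leadingVariance (jointCDF μ) J lam x n m|
              ≤ C * ((n : ℝ)⁻¹ * ((m : ℝ) ^ 2)⁻¹)
                + (if J ≠ Finset.univ then ε * ((n : ℝ)⁻¹ * (√(m : ℝ))⁻¹) else 0)) ∧
    (∀ (x : Fin d → ℝ), x ∈ simplex d → (∃ i, x i = 0) →
      ∀ n m : ℕ, 1 ≤ n → 1 ≤ m →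
        ∀ {Ω : Type*} [MeasurableSpace Ω] (P : Measure Ω) [IsProbabilityMeasure P]
          (X : Fin n → Ω → Fin d → ℝ),
          (∀ j, HasLaw (X j) μ P) → iIndepFun X P →
          (∀ᵐ ω ∂P, bernsteinEstimator (fun j => X j ω) m x = 0) ∧
          variance (fun ω => bernsteinEstimator (fun j => X j ω) m x) P = 0) := by
  refine ⟨fun J lam hlam => ?_, fun x _ hx0 n m _ hm Ω _ P _ X hX _ => ?_⟩
  · obtain ⟨C, hC⟩ := exists_kernelVariance_sub_leadingVariance_le hd μ hC3 hface J lam hlam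
    refine ⟨C, fun x hx ε hε => ?_⟩
    obtain ⟨M, hM⟩ := hC x hx ε hε
    refine ⟨M, fun n m _ hm hy Ω _ P _ X hX hind => ?_⟩
    rw [variance_bernsteinEstimator μ P X hX hind, leadingVariance_eq, ← mul_sub, abs_mul,
      abs_of_nonneg (by positivity)]
    refine (mul_le_mul_of_nonneg_left (hM m hm hy) (by positivity)).trans (le_of_eq ?_)
    split_ifs <;> ring
  · have h := bernsteinEstimator_eq_zero μ hm hx0 hface P X hX
    exact ⟨h, (variance_congr h).trans (variance_zero P)⟩
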